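/- Graphs are finite; loops and multiple edges are allowed. Let $\mathcal A_3=\mathbb Z[x]/(x^3)$, graded by $\deg x=1$. For a graph $G$ with a chosen linear order of its edge set $E(G)$, and for $s\subseteq E(G)$, let $[G:s]$ be the subgraph with all vertices of $G$ and edge set $s$. The cochain complex of $G$ is $C^i(G)=\bigoplus_{|s|=i}\mathcal A_3^{\otimes \pi_0([G:s])}$ (one tensor factor, over $\mathbb Z$, for each connected component of $[G:s]$), with differential given on the summand of $s$ by $d=\sum_{e\notin s}(-1)^{t(s,e)}d_e$, where $t(s,e)$ is the number of elements of $s$ preceding $e$, and $d_e$, with values in the summand of $s\cup\{e\}$, multiplies the factors of the two components joined by $e$, and is the identity if both ends of $e$ lie in the same component. The differential preserves the total degree $j$ in $x$, and $H^{i,j}_{\mathcal A_3}(G)$ denotes the degree $j$ part of the $i$-th cohomology. Let $v(G)$ be the number of vertices of $G$, and write $\mathcal H(G)=H^{1,2v(G)-3}_{\mathcal A_3}(G)$. The one-vertex product $G*(v=w)H$ is obtained from the disjoint union of $G$ and $H$ by identifying a vertex $v$ of $G$ with a vertex $w$ of $H$. For distinct vertices $v_1,v_2$ of $G$ and distinct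 vertices $w_1,w_2$ of $H$, the two-vertex product $G^{*(v_1=w_1)}_{*(v_2=w_2)}H$ is obtained from the disjoint union by identifying $v_1$ with $w_1$ and $v_2$ with $w_2$; the graphs $G^{*(v_1=w_1)}_{*(v_2=w_2)}H$ and $G^{*(v_1=w_2)}_{*(v_2=w_1)}H$ are said to differ by a Whitney flip. 2-isomorphism is the smallest equivalence relation on isomorphism classes of graphs such that any two one-vertex products $G*(v=w)H$ and $G*(v'=w')H$ of the same graphs $G$, $H$ are 2-isomorphic, and any two graphs that differ by a Whitney flip are 2-isomorphic. Theorem 6.2. The following isomorphisms of abelian groups hold, for any choice of the edge orders. (1) Let $v,w$ be vertices of a graph $Y$ (not necessarily connected) with $d_Y(v,w)>4$, where $d_Y(v,w)=\infty$ is allowed, and let $Y'=Y/(v=w)$ be obtained from $Y$ by identifying $v$ with $w$. Then $\mathcal H(Y')\cong\mathcal H(Y)$. In particular, if $G$ and $H$ have no loops, then $\mathcal H(G*(v=w)H)\cong\mathcal H(G)\oplus\mathcal H(H)$ for all vertices $v$ of $G$ and $w$ of $H$. (2) For all distinct vertices $v_1,v_2$ of $G$ and distinct vertices $w_1,w_2$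 of $H$, $$\mathcal H\bigl(G^{*(v_1=w_1)}_{*(v_2=w_2)}H\bigr)\cong\mathcal H\bigl(G^{*(v_1=w_2)}_{*(v_2=w_1)}H\bigr).$$ (3) If $G_1$ and $G_2$ are 2-isomorphic, then $\mathcal H(G_1)\cong\mathcal H(G_2)$. -/

import Mathlib

open scoped TensorProduct

universe u

/-- A finite multigraph: finite types of vertices and edges, each edge having an unordered pair of
end points. Loops (both ends equal) and multiple edges are allowed. -/
structure Multigraph : Type (u + 1) where
  /-- The vertices. -/
  V : Type u
  /-- The edges. -/
  E : Type u
  /-- The unordered pair of end points of an edge. -/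
  ends : E → Sym2 V
  finite_V : Finite V
  finite_E : Finite E

namespace Multigraph

attribute [instance] finite_V finite_E

/-- An isomorphism of multigraphs. -/
structure Iso (G H : Multigraph.{u}) where
  vertexEquiv : G.V ≃ H.V
  edgeEquiv : G.E ≃ H.E
  ends_edgeEquiv : ∀ e, H.ends (edgeEquiv e) = (G.ends e).map vertexEquiv

/-- A multigraph is loopless if no edge has two equal end points. -/
def Loopless (G : Multigraph.{u}) : Prop := ∀ e, ¬ (G.ends e).IsDiag

/-! ### Distance and connected components -/

/-- The simple graph of adjacency in the spanning subgraph `[G : s]`, which has all the vertices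
of `G` and the edges in `s`: distinct vertices are adjacent iff some edge in `s` joins them. -/
def spanning (G : Multigraph.{u}) (s : Set G.E) : SimpleGraph G.V :=
  SimpleGraph.fromRel fun a b => ∃ e ∈ s, G.ends e = s(a, b)

/-- The distance between two vertices, `⊤` if they lie in different components. -/
noncomputable def edist (G : Multigraph.{u}) (a b : G.V) : ℕ∞ :=
  (G.spanning Set.univ).edist a b

/-- The connected components of `[G : s]`. -/
abbrev Comp (G : Multigraph.{u}) (s : Finset G.E) : Type u :=
  (G.spanning (s : Set G.E)).ConnectedComponent

theorem spanning_mono (G : Multigraph.{u}) {s t : Set G.E} (h : s ⊆ t) :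
    G.spanning s ≤ G.spanning t := by
  intro a b hab
  simp only [spanning, SimpleGraph.fromRel_adj] at hab ⊢
  obtain ⟨hne, ⟨e, he, h1⟩ | ⟨e, he, h1⟩⟩ := hab
  · exact ⟨hne, Or.inl ⟨e, h he, h1⟩⟩
  · exact ⟨hne, Or.inr ⟨e, h he, h1⟩⟩

/-- For `s ⊆ t`, the map sending a component of `[G : s]` to the component of `[G : t]`
containing it. -/
def compMap (G : Multigraph.{u}) {s t : Finset G.E} (h : s ⊆ t) : G.Comp s → G.Comp t :=
  SimpleGraph.ConnectedComponent.map
    (SimpleGraph.Hom.ofLE (G.spanning_mono (Finset.coe_subset.2 h)))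

end Multigraph

/-! ### Tensor powers of a commutative ring -/

theorem prod_fiber_update {ι κ : Type u} [Fintype ι] [DecidableEq ι] [DecidableEq κ]
    {A : Type} [CommRing A] (p : ι → κ) (a : ι → A) (i : ι) (z : A) :
    (fun k => ∏ j with p j = k, Function.update a i z j) =
      Function.update (fun k => ∏ j with p j = k, a j) (p i)
        (z * ∏ j ∈ (Finset.univ.filter fun j => p j = p i).erase i, a j) := by
  funext k
  by_cases hk : k = p i
  · subst hk
    rw [Function.update_self, ← Finset.mul_prod_erase _ _ (a := i) (by simp),
      Function.update_self]
    congr 1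
    exact Finset.prod_congr rfl fun j hj => Function.update_of_ne (Finset.ne_of_mem_erase hj) z a
  · rw [Function.update_of_ne hk]
    refine Finset.prod_congr rfl fun j hj => Function.update_of_ne ?_ z a
    rintro rfl
    exact hk (Finset.mem_filter.1 hj).2.symm

open Classical in
/-- For `p : ι → κ`, the linear map `A^{⊗ ι} → A^{⊗ κ}` that multiplies together the factors whose
indices have the same image under `p`: the pure tensor of `(aᵢ)` goes to the pure tensor whose
`k`-th factor is the product of the `aᵢ` with `p i = k`. -/
noncomputable def fiberMul {ι κ : Type u} [Finite ι] (A : Type) [CommRing A] (p : ι → κ) :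
    (⨂[ℤ] _ : ι, A) →ₗ[ℤ] (⨂[ℤ] _ : κ, A) :=
  letI := Fintype.ofFinite ι
  PiTensorProduct.lift
    { toFun := fun a => PiTensorProduct.tprod ℤ fun k => ∏ i with p i = k, a i
      map_update_add' := fun a i x y => by
        have h := fun z => prod_fiber_update p a i z
        rw [h, h, h, add_mul, MultilinearMap.map_update_add]
      map_update_smul' := fun a i c x => by
        have h := fun z => prod_fiber_update p a i z
        rw [h, h, smul_mul_assoc, MultilinearMap.map_update_smul] }

/-- The algebra of truncated polynomials `ℤ[x]/(x^m)`. -/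
abbrev TruncPoly (m : ℕ) : Type := AdjoinRoot (Polynomial.X ^ m : Polynomial ℤ)

/-- The homogeneous part of degree `j` of the tensor power of `ℤ[x]/(x^m)` indexed by `ι`, where
`x` has degree `1`: it is spanned by the pure tensors of powers of `x` with exponents of
sum `j`. -/
noncomputable def homogeneousPart (m : ℕ) (ι : Type u) [Finite ι] (j : ℤ) :
    Submodule ℤ (⨂[ℤ] _ : ι, TruncPoly m) :=
  Submodule.span ℤ
    {y | ∃ a : ι → ℕ, ((∑ᶠ i, a i : ℕ) : ℤ) = j ∧
      y = PiTensorProduct.tprod ℤ fun i => (AdjoinRoot.root (Polynomial.X ^ m) ^ a i : TruncPoly m)}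

/-! ### Chromatic graph cohomology -/

namespace Multigraph

/-- The `i`-cochains of `G` over the ring `A`: the direct sum, over all sets `s` of `i` edges, of
the tensor products of copies of `A`, one for each component of `[G : s]`. -/
abbrev Cochain (G : Multigraph.{u}) (A : Type) [CommRing A] (i : ℕ) : Type u :=
  (s : {s : Finset G.E // s.card = i}) → ⨂[ℤ] _ : G.Comp s.1, A

open Classical in
/-- The differential `d = ∑_{e ∉ s} (-1)^{t(s,e)} d_e`, where `t(s,e)` is the number of elements of
`s` that precede `e` in the order `o` of the edges, and `d_e`, from the summand of `s` to the
summand of `s ∪ {e}`, multiplies the factors of the two components joined by `e`, and is the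
identity if `e` joins vertices of the same component. The formula gives the component of `d f` at
a set `t` of `i + 1` edges: the summands that contribute to it are those of `s = t \ {e}`
for `e ∈ t`. -/
noncomputable def d (G : Multigraph.{u}) (A : Type) [CommRing A] (o : LinearOrder G.E) (i : ℕ) :
    G.Cochain A i →ₗ[ℤ] G.Cochain A (i + 1) :=
  LinearMap.pi fun t => ∑ e : {e // e ∈ t.1},
    (-1 : ℤ) ^ ((t.1.erase e.1).filter fun e' => o.lt e' e.1).card •
      (fiberMul A (G.compMap (Finset.erase_subset e.1 t.1))) ∘ₗ
        LinearMap.proj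
          (⟨t.1.erase e.1, by rw [Finset.card_erase_of_mem e.2, t.2, Nat.add_sub_cancel]⟩ :
            {s : Finset G.E // s.card = i})

/-- The cochains of bidegree `(i, j)` over `ℤ[x]/(x^m)`. -/
noncomputable def gradedCochain (G : Multigraph.{u}) (m i : ℕ) (j : ℤ) :
    Submodule ℤ (G.Cochain (TruncPoly m) i) :=
  Submodule.pi Set.univ fun s => homogeneousPart m (G.Comp s.1) j

/-- The cocycles of bidegree `(i, j)`. -/
noncomputable def cocycles (G : Multigraph.{u}) (o : LinearOrder G.E) (m i : ℕ) (j : ℤ) :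
    Submodule ℤ (G.Cochain (TruncPoly m) i) :=
  LinearMap.ker (G.d (TruncPoly m) o i) ⊓ G.gradedCochain m i j

/-- The coboundaries of bidegree `(i, j)`: the images of the cochains of bidegree `(i - 1, j)`. -/
noncomputable def coboundaries (G : Multigraph.{u}) (o : LinearOrder G.E) (m : ℕ) :
    (i : ℕ) → (j : ℤ) → Submodule ℤ (G.Cochain (TruncPoly m) i)
  | 0, _ => ⊥
  | i + 1, j => (G.gradedCochain m i j).map (G.d (TruncPoly m) o i)

/-- The chromatic graph cohomology `H^{i,j}(G)` over the algebra `ℤ[x]/(x^m)`, computed with the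
order `o` of the edges. -/
abbrev Cohomology (G : Multigraph.{u}) (o : LinearOrder G.E) (m i : ℕ) (j : ℤ) : Type u :=
  ↥(G.cocycles o m i j) ⧸ (G.coboundaries o m i j).submoduleOf (G.cocycles o m i j)

/-- The group `H^{1,2v-3}(G)` over `ℤ[x]/(x^3)`, where `v` is the number of vertices of `G`. -/
abbrev firstCohomology (G : Multigraph.{u}) (o : LinearOrder G.E) : Type u :=
  G.Cohomology o 3 1 (2 * (Nat.card G.V : ℤ) - 3)

/-! ### Gluing -/

/-- The quotient of a multigraph in which vertices related by `r` are identified; all edges are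
kept. -/
def identify (G : Multigraph.{u}) (r : G.V → G.V → Prop) : Multigraph.{u} where
  V := Quot r
  E := G.E
  ends e := (G.ends e).map (Quot.mk r)
  finite_V := inferInstance
  finite_E := inferInstance

/-- The multigraph `G / (v = w)` obtained by identifying the vertices `v` and `w`. -/
def identifyVertices (G : Multigraph.{u}) (v w : G.V) : Multigraph.{u} :=
  G.identify fun a b => a = v ∧ b = w

/-- The disjoint union of two multigraphs. -/
def disjointUnion (G H : Multigraph.{u}) : Multigraph.{u} where
  V := G.V ⊕ H.V
  E := G.E ⊕ H.E
  ends := Sum.elim (fun e => (G.ends e).map Sum.inl) (fun e => (H.ends e).map Sum.inr)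
  finite_V := inferInstance
  finite_E := inferInstance

/-- The one-vertex product `G *(v = w) H`: `G` and `H` are glued by identifying the vertex `v`
of `G` with the vertex `w` of `H`. -/
def oneVertexProduct (G H : Multigraph.{u}) (v : G.V) (w : H.V) : Multigraph.{u} :=
  (G.disjointUnion H).identifyVertices (Sum.inl v) (Sum.inr w)

/-- The two-vertex product: `G` and `H` are glued by identifying the vertex `v₁` of `G` with the
vertex `w₁` of `H`, and `v₂` with `w₂`. -/
def twoVertexProduct (G H : Multigraph.{u}) (v₁ v₂ : G.V) (w₁ w₂ : H.V) : Multigraph.{u} :=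
  (G.disjointUnion H).identify fun a b =>
    (a = Sum.inl v₁ ∧ b = Sum.inr w₁) ∨ (a = Sum.inl v₂ ∧ b = Sum.inr w₂)

/-- 2-isomorphism: the smallest equivalence relation on isomorphism classes of multigraphs such
that any two one-vertex products of `G` and `H` are related, and any two multigraphs
that differ by a Whitney flip are related. -/
inductive TwoIsomorphic : Multigraph.{u} → Multigraph.{u} → Prop
  | iso {G₁ G₂ : Multigraph.{u}} (f : Iso G₁ G₂) : TwoIsomorphic G₁ G₂
  | oneVertex (G H : Multigraph.{u}) (v v' : G.V) (w w' : H.V) :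
      TwoIsomorphic (oneVertexProduct G H v w) (oneVertexProduct G H v' w')
  | whitneyFlip (G H : Multigraph.{u}) (v₁ v₂ : G.V) (w₁ w₂ : H.V) (hv : v₁ ≠ v₂) (hw : w₁ ≠ w₂) :
      TwoIsomorphic (twoVertexProduct G H v₁ v₂ w₁ w₂) (twoVertexProduct G H v₁ v₂ w₂ w₁)
  | symm {G₁ G₂ : Multigraph.{u}} (h : TwoIsomorphic G₁ G₂) : TwoIsomorphic G₂ G₁
  | trans {G₁ G₂ G₃ : Multigraph.{u}} (h : TwoIsomorphic G₁ G₂) (h' : TwoIsomorphic G₂ G₃) :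
      TwoIsomorphic G₁ G₃

end Multigraph

/-! ### The group of edge-vertex pairs of a simple graph -/

section EdgeVertex

variable {V : Type*} [Fintype V]

/-! Degree 2v − 3 lies so near the top that little of the complex survives there. Let G be loopless.
A monomial in C^0 falls short of the top degree 2v by 3. On a single edge e the top degree is 2(v −
1), so a monomial falls short by 1: it amounts to e together with a vertex c of G/e. Two
non-parallel edges leave at most v − 2 components, with top degree at most 2v − 4, so they
contribute nothing. Hence a 1-cocycle is a cochain that agrees on parallel edges, and the group is
generated by pairs (ab, c) that see only the underlying simple graph. Its relations are the
coboundaries of the two kinds of monomials: exponent 1 at a, b, c gives (ab, c) + (bc, a) + (ca, b)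
= 0, and exponents 0 at a, 1 at b give ∑_c (ac, b) = 0. This is `Loopless.nonempty_equiv_pairGroup`.
If there is a loop, H^1 vanishes (`subsingleton_of_isDiag`). The operations in question neither
create nor destroy looplessness, so everything reduces to `EdgeVertexGroup`.

The relations are local. The triple relation kills (ab, c) if c is away from a and b; the star
relation kills it if a and c are not adjacent and have no common neighbour except possibly b. When v
and w are identified, the new configurations are a neighbour b of v and a neighbour c of w, meeting
at v = w. A second common neighbour d of b and c would give a path v, b, d, c, w of length 4, which
the distance hypothesis excludes, so these generators vanish. A one-vertex product identifies two
vertices of a disjoint union, at infinite distance, and the group of a disjoint union is a product.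

For a Whitney flip along {p, q} with side A, an edge meeting A is sent to minus its image under the
exchange of p and q, and the other edges are kept. The sign comes from (pa, b) = −(qa, b) for a and
b on opposite sides (`SimpleWhitneyFlip.cross`). The edge pq belongs to neither side and needs the
correction `corr`, which restores the relations involving p and q. Flipping twice is the identity.
-/

/-- The defining relations of `EdgeVertexGroup S`. -/
inductive EdgeVertexRel (S : SimpleGraph V) : (V × V × V →₀ ℤ) → Prop
  | swap (a b c : V) :
      EdgeVertexRel S (Finsupp.single (a, b, c) 1 - Finsupp.single (b, a, c) 1)
  | nonadj (a b c : V) (h : ¬ S.Adj a b) : EdgeVertexRel S (Finsupp.single (a, b, c) 1)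
  | ends (a b : V) : EdgeVertexRel S (Finsupp.single (a, b, a) 1 - Finsupp.single (a, b, b) 1)
  | triple (a b c : V) (hab : a ≠ b) (hbc : b ≠ c) (hca : c ≠ a) :
      EdgeVertexRel S (Finsupp.single (a, b, c) 1 + Finsupp.single (b, c, a) 1 +
        Finsupp.single (c, a, b) 1)
  | star (a b : V) (hab : a ≠ b) : EdgeVertexRel S (∑ c, Finsupp.single (a, c, b) 1)

/-- The abelian group generated by the pairs of an edge `ab` of `S` and a vertex `c` of the
graph in which `ab` is contracted, with one relation for each set of three vertices and
one for each ordered pair of distinct vertices. -/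
abbrev EdgeVertexGroup (S : SimpleGraph V) : Type _ :=
  (V × V × V →₀ ℤ) ⧸ Submodule.span ℤ {r | EdgeVertexRel S r}

/-- A function on triples of vertices that respects the relations of `EdgeVertexGroup S`. -/
structure IsEdgeVertexFun (S : SimpleGraph V) {M : Type*} [AddCommGroup M]
    (F : V → V → V → M) : Prop where
  swap : ∀ a b c, F a b c = F b a c
  nonadj : ∀ a b c, ¬ S.Adj a b → F a b c = 0
  ends : ∀ a b, F a b a = F a b b
  triple : ∀ a b c, a ≠ b → b ≠ c → c ≠ a → F a b c + F b c a + F c a b = 0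
  star : ∀ a b, a ≠ b → ∑ c, F a c b = 0

namespace EdgeVertexGroup

variable (S : SimpleGraph V)

/-- The generator of `EdgeVertexGroup S` given by the pair of vertices `a`, `b` and the
vertex `c`. -/
noncomputable def of (a b c : V) : EdgeVertexGroup S := Submodule.Quotient.mk (Finsupp.single (a, b, c) 1)

theorem mk_eq_zero_of_rel {r : V × V × V →₀ ℤ} (h : EdgeVertexRel S r) :
    (Submodule.Quotient.mk r : EdgeVertexGroup S) = 0 :=
  (Submodule.Quotient.mk_eq_zero _).2 (Submodule.subset_span h)

theorem isEdgeVertexFun_of : IsEdgeVertexFun S (of S) where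
  swap a b c := sub_eq_zero.1 (mk_eq_zero_of_rel S (.swap a b c))
  nonadj a b c h := mk_eq_zero_of_rel S (.nonadj a b c h)
  ends a b := sub_eq_zero.1 (mk_eq_zero_of_rel S (.ends a b))
  triple a b c hab hbc hca := mk_eq_zero_of_rel S (.triple a b c hab hbc hca)
  star a b hab := by
    have h := mk_eq_zero_of_rel S (.star a b hab)
    rw [← Submodule.mkQ_apply, map_sum] at h
    exact h

variable {S} {M : Type*} [AddCommGroup M]

/-- The universal property of `EdgeVertexGroup S`. -/
noncomputable def lift (F : V → V → V → M) (hF : IsEdgeVertexFun S F) :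
    EdgeVertexGroup S →ₗ[ℤ] M :=
  Submodule.liftQ _ (Finsupp.linearCombination ℤ fun t : V × V × V => F t.1 t.2.1 t.2.2) <| by
    rw [Submodule.span_le]
    rintro r (⟨a, b, c⟩ | ⟨a, b, c, h⟩ | ⟨a, b⟩ | ⟨a, b, c, hab, hbc, hca⟩ | ⟨a, b, hab⟩)
    · simpa [sub_eq_zero] using hF.swap a b c
    · simpa using hF.nonadj a b c h
    · simpa [sub_eq_zero] using hF.ends a b
    · simpa using hF.triple a b c hab hbc hca
    · simpa using hF.star a b hab

@[simp]
theorem lift_of (F : V → V → V → M) (hF : IsEdgeVertexFun S F) (a b c : V) :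
    lift F hF (of S a b c) = F a b c := by
  simp [lift, of]

theorem hom_ext {f g : EdgeVertexGroup S →ₗ[ℤ] M}
    (h : ∀ a b c, f (of S a b c) = g (of S a b c)) : f = g := by
  apply Submodule.linearMap_qext
  apply Finsupp.lhom_ext'
  rintro ⟨a, b, c⟩
  apply LinearMap.ext_ring
  exact h a b c

theorem span_range_of :
    Submodule.span ℤ (Set.range fun t : V × V × V => of S t.1 t.2.1 t.2.2) = ⊤ := by
  rw [eq_top_iff]
  rintro x -
  induction x using Submodule.Quotient.induction_on with | _ x =>
  induction x using Finsupp.induction_linear with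
  | zero => exact zero_mem _
  | add x y hx hy => exact add_mem hx hy
  | single t n =>
    have : (Submodule.Quotient.mk (Finsupp.single t n) : EdgeVertexGroup S) =
        n • of S t.1 t.2.1 t.2.2 := by
      rw [of, ← Submodule.Quotient.mk_smul]
      simp
    rw [this]
    exact Submodule.smul_mem _ _ (Submodule.subset_span ⟨t, rfl⟩)

theorem range_eq_top (f : M →ₗ[ℤ] EdgeVertexGroup S) (h : ∀ a b c, of S a b c ∈ f.range) :
    f.range = ⊤ := by
  rw [eq_top_iff, ← span_range_of, Submodule.span_le]
  rintro _ ⟨t, rfl⟩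
  exact h _ _ _

end EdgeVertexGroup

/-! ### Vanishing criteria for generators -/

namespace IsEdgeVertexFun

variable {S : SimpleGraph V} {M : Type*} [AddCommGroup M] {F : V → V → V → M}

/-- In the triple relation the other two terms have non-edges `bc` and `ca`. -/
theorem eq_zero_of_nonadj (hF : IsEdgeVertexFun S F) {a b c : V} (hca : c ≠ a) (hcb : c ≠ b)
    (h1 : ¬ S.Adj c a) (h2 : ¬ S.Adj c b) : F a b c = 0 := by
  by_cases hab : a = b
  · exact hF.nonadj _ _ _ (by simp [hab])
  · have := hF.triple a b c hab hcb.symm hca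
    rwa [hF.nonadj b c a (fun h => h2 h.symm), hF.nonadj c a b h1, add_zero, add_zero] at this

/-- If `a` and `c` are not adjacent and `b` is their only possible common neighbour, then the
pair of the edge `ab` and the vertex `c` vanishes. -/
theorem eq_zero_of_unique_common (hF : IsEdgeVertexFun S F) {a b c : V} (hac : a ≠ c)
    (h1 : ¬ S.Adj a c) (h2 : ∀ d, S.Adj a d → S.Adj d c → d = b) : F a b c = 0 := by
  -- In the star relation at `a`, `c`, a term survives only if its middle vertex is a common
  -- neighbour of `a` and `c`.
  have h := hF.star a c hac
  rwa [Finset.sum_eq_single b] at h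
  · intro d _ hdb
    by_cases had : S.Adj a d
    · by_cases hdc : d = c
      · exact absurd (hdc ▸ had) h1
      · refine hF.eq_zero_of_nonadj hac.symm (Ne.symm hdc) (fun h => h1 h.symm) fun h => ?_
        exact hdb (h2 d had h.symm)
    · exact hF.nonadj _ _ _ had
  · simp

end IsEdgeVertexFun

/-! ### Invariance under graph isomorphism -/

namespace EdgeVertexGroup

theorem isEdgeVertexFun_of_iso {V' : Type*} [Fintype V'] {S : SimpleGraph V}
    {S' : SimpleGraph V'} (f : S ≃g S') :
    IsEdgeVertexFun S fun a b c => of S' (f a) (f b) (f c) := by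
  have h := isEdgeVertexFun_of S'
  refine ⟨fun a b c => h.swap _ _ _, fun a b c hab => h.nonadj _ _ _ (by rwa [f.map_adj_iff]),
    fun a b => h.ends _ _, fun a b c h1 h2 h3 => h.triple _ _ _ (by simpa using h1)
      (by simpa using h2) (by simpa using h3), fun a b hab => ?_⟩
  rw [← h.star (f a) (f b) (by simpa using hab)]
  exact Equiv.sum_comp f.toEquiv fun c => of S' (f a) c (f b)

/-- An isomorphism of simple graphs induces an isomorphism of the groups of edge-vertex pairs. -/
theorem nonempty_equiv_of_iso {V' : Type*} [Fintype V'] {S : SimpleGraph V} {S' : SimpleGraph V'}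
    (f : S ≃g S') : Nonempty (EdgeVertexGroup S ≃ₗ[ℤ] EdgeVertexGroup S') := by
  refine ⟨LinearEquiv.ofLinearMap (lift _ (isEdgeVertexFun_of_iso f))
    (lift _ (isEdgeVertexFun_of_iso f.symm)) ?_ ?_⟩ <;>
    exact hom_ext (by simp)

end EdgeVertexGroup

end EdgeVertex

/-! ### Disjoint unions -/

section Sum

variable {V W : Type*} [Fintype V] [Fintype W]

namespace EdgeVertexGroup

/-- The group of a disjoint union is the product of the groups. -/
theorem nonempty_equiv_prod (S : SimpleGraph V) (T : SimpleGraph W) :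
    Nonempty (EdgeVertexGroup (S ⊕g T) ≃ₗ[ℤ] EdgeVertexGroup S × EdgeVertexGroup T) := by
  have hS := isEdgeVertexFun_of S
  have hT := isEdgeVertexFun_of T
  have hU := isEdgeVertexFun_of (S ⊕g T)
  -- Mixed triples may go to 0: either the first two vertices are not adjacent, or the third lies in
  -- the other summand, away from the edge.
  let F : V ⊕ W → V ⊕ W → V ⊕ W → EdgeVertexGroup S × EdgeVertexGroup T
    | .inl a, .inl b, .inl c => (of S a b c, 0)
    | .inr a, .inr b, .inr c => (0, of T a b c)
    | _, _, _ => 0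
  have hF : IsEdgeVertexFun (S ⊕g T) F := by
    constructor
    · rintro (a | a) (b | b) (c | c) <;> try rfl
      · exact congrArg (·, 0) (hS.swap a b c)
      · exact congrArg (0, ·) (hT.swap a b c)
    · rintro (a | a) (b | b) (c | c) h <;> simp [F] at h ⊢
      · exact hS.nonadj _ _ _ h
      · exact hT.nonadj _ _ _ h
    · rintro (a | a) (b | b) <;> try rfl
      · exact congrArg (·, 0) (hS.ends a b)
      · exact congrArg (0, ·) (hT.ends a b)
    · rintro (a | a) (b | b) (c | c) h1 h2 h3 <;> simp [F] at h1 h2 h3 ⊢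
      · exact hS.triple _ _ _ h1 h2 h3
      · exact hT.triple _ _ _ h1 h2 h3
    · rintro (a | a) (b | b) h <;> simp [F, Fintype.sum_sum_type] at h ⊢
      · simpa only [map_sum, LinearMap.inl_apply, map_zero] using
          congrArg (LinearMap.inl ℤ (EdgeVertexGroup S) (EdgeVertexGroup T)) (hS.star a b h)
      · simpa only [map_sum, LinearMap.inr_apply, map_zero] using
          congrArg (LinearMap.inr ℤ (EdgeVertexGroup S) (EdgeVertexGroup T)) (hT.star a b h)
  have hl : IsEdgeVertexFun S fun a b c => of (S ⊕g T) (.inl a) (.inl b) (.inl c) := by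
    refine ⟨fun a b c => hU.swap _ _ _, fun a b c h => hU.nonadj _ _ _ (by simpa using h),
      fun a b => hU.ends _ _, fun a b c h1 h2 h3 => hU.triple _ _ _ (by simpa using h1)
        (by simpa using h2) (by simpa using h3), fun a b hab => ?_⟩
    have := hU.star (.inl a) (.inl b) (by simpa using hab)
    rw [Fintype.sum_sum_type] at this
    simpa [hU.nonadj (Sum.inl a) (Sum.inr _) _ (by simp)] using this
  have hr : IsEdgeVertexFun T fun a b c => of (S ⊕g T) (.inr a) (.inr b) (.inr c) := by
    refine ⟨fun a b c => hU.swap _ _ _, fun a b c h => hU.nonadj _ _ _ (by simpa using h),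
      fun a b => hU.ends _ _, fun a b c h1 h2 h3 => hU.triple _ _ _ (by simpa using h1)
        (by simpa using h2) (by simpa using h3), fun a b hab => ?_⟩
    have := hU.star (.inr a) (.inr b) (by simpa using hab)
    rw [Fintype.sum_sum_type] at this
    simpa [hU.nonadj (Sum.inr a) (Sum.inl _) _ (by simp)] using this
  refine ⟨LinearEquiv.ofLinearMap (lift F hF) ((lift _ hl).coprod (lift _ hr)) ?_ ?_⟩
  · apply LinearMap.prod_ext <;> exact hom_ext (by simp [F])
  · apply hom_ext
    rintro (a | a) (b | b) (c | c) <;> simp [F]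
    · exact (hU.eq_zero_of_nonadj (by simp) (by simp) (by simp) (by simp)).symm
    · exact (hU.nonadj _ _ _ (by simp)).symm
    · exact (hU.nonadj _ _ _ (by simp)).symm
    · exact (hU.nonadj _ _ _ (by simp)).symm
    · exact (hU.nonadj _ _ _ (by simp)).symm
    · exact (hU.eq_zero_of_nonadj (by simp) (by simp) (by simp) (by simp)).symm

end EdgeVertexGroup

end Sum

/-! ### Identification of two vertices that are far from each other -/

namespace EdgeVertexGroup

/-- The data of a surjection `π` that identifies the vertices `v` and `w` of `S` and is otherwise
injective, where `T` is the image of `S`. The function `δ`, which varies by at most `1` along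
edges, shows that the distance of `v` and `w` is greater than `4`. -/
structure FarIdentification {V W : Type*} (S : SimpleGraph V) (T : SimpleGraph W) (π : V → W)
    (v w : V) (δ : V → ℤ) : Prop where
  surj : Function.Surjective π
  eq_iff : ∀ a b, π a = π b ↔ a = b ∨ (a = v ∧ b = w) ∨ (a = w ∧ b = v)
  adj_iff : ∀ x y, T.Adj x y ↔ ∃ a b, π a = x ∧ π b = y ∧ S.Adj a b
  left : δ v = 0
  right : δ w = 5
  lipschitz : ∀ a b, S.Adj a b → δ a ≤ δ b + 1

namespace FarIdentification

theorem symm {V W : Type*} {S : SimpleGraph V} {T : SimpleGraph W} {π : V → W} {v w : V}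
    {δ : V → ℤ} (h : FarIdentification S T π v w δ) :
    FarIdentification S T π w v fun a => 5 - δ a where
  surj := h.surj
  eq_iff a b := by rw [h.eq_iff]; tauto
  adj_iff := h.adj_iff
  left := by simp [h.right]
  right := by simp [h.left]
  lipschitz a b hab := by have := h.lipschitz b a hab.symm; omega

theorem adj_map {V W : Type*} {S : SimpleGraph V} {T : SimpleGraph W} {π : V → W} {v w : V}
    {δ : V → ℤ} (h : FarIdentification S T π v w δ) {a b : V} (hab : S.Adj a b) :
    T.Adj (π a) (π b) := (h.adj_iff _ _).2 ⟨a, b, rfl, rfl, hab⟩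

section

variable {V W : Type*} {S : SimpleGraph V} {T : SimpleGraph W} {π : V → W} {v w : V} {δ : V → ℤ}

theorem of_adj (h : FarIdentification S T π v w δ) (a b : V) (hab : S.Adj a b) :
    δ a ≤ δ b + 1 ∧ δ b ≤ δ a + 1 ∧ a ≠ b ∧ S.Adj b a :=
  ⟨h.lipschitz a b hab, h.lipschitz b a hab.symm, hab.ne, hab.symm⟩

/-- The only two distinct vertices with the same image have values 0 and 5 of `δ`. -/
theorem eq_of_map_eq (h : FarIdentification S T π v w δ) {a b : V} (hab : π a = π b)
    (h1 : δ a ≤ δ b + 4) (h2 : δ b ≤ δ a + 4) : a = b := by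
  have := h.left
  have := h.right
  have := (h.eq_iff a b).1 hab
  grind

/-- If lifting the edge exchanges `v` and `w` at one end, the other end is a neighbour of the wrong
one, and the values of `δ` at `a` and `b` differ by at least 4. -/
theorem adj_of_adj_map (h : FarIdentification S T π v w δ) {a b : V} (hab : T.Adj (π a) (π b))
    (h1 : δ a ≤ δ b + 3) (h2 : δ b ≤ δ a + 3) : S.Adj a b := by
  have := h.left
  have := h.right
  obtain ⟨x, y, hx, hy, hxy⟩ := (h.adj_iff _ _).1 hab
  have := h.of_adj _ _ hxy
  rw [h.eq_iff] at hx hy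
  grind

end

variable {V W : Type*} [Fintype V] [Fintype W]
  {S : SimpleGraph V} {T : SimpleGraph W} {π : V → W} {v w : V} {δ : V → ℤ}

omit [Fintype V] in
/-- The images of a neighbour `c` of `w` and a neighbour `b` of `v` have no common neighbour
other than the image of `v`. -/
theorem cross_eq_zero (h : FarIdentification S T π v w δ) {M : Type*} [AddCommGroup M]
    {F : W → W → W → M} (hF : IsEdgeVertexFun T F) {b c : V} (hb : S.Adj v b) (hc : S.Adj c w) :
    F (π c) (π v) (π b) = 0 := by
  have h1 := h.left
  have h2 := h.right
  have := h.of_adj _ _ hb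
  have := h.of_adj _ _ hc
  apply hF.eq_zero_of_unique_common
  · intro hcb
    have := (h.eq_iff c b).1 hcb
    grind
  · intro hcb
    obtain ⟨x, y, hx, hy, hxy⟩ := (h.adj_iff _ _).1 hcb
    have := h.of_adj _ _ hxy
    rw [h.eq_iff] at hx hy
    grind
  -- A common neighbour other than the image of `v` would give a path `v`, `b`, `d`, `c`, `w` of
  -- length 4.
  · intro d h4 h5
    obtain ⟨x, y, hx, rfl, hxy⟩ := (h.adj_iff _ _).1 h4
    obtain ⟨z, t, hz, ht, hzt⟩ := (h.adj_iff _ _).1 h5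
    have := h.of_adj _ _ hxy
    have := h.of_adj _ _ hzt
    rw [h.eq_iff] at hx hz ht ⊢
    grind

-- This disposes of the extra terms in the star relation at the glued vertex: edges inherited from
-- `w`, paired with a vertex `b` near `v`. If `b` is not adjacent to `v`, the triple relation
-- suffices, since `b` is too far from `c`.
omit [Fintype V] in
theorem cross_eq_zero' (h : FarIdentification S T π v w δ) {M : Type*} [AddCommGroup M]
    {F : W → W → W → M} (hF : IsEdgeVertexFun T F) {b c : V} (hbv : b ≠ v) (hb : δ b ≤ 2)
    (hb' : -2 ≤ δ b) (hc : S.Adj c w) : F (π v) (π c) (π b) = 0 := by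
  have h1 := h.left
  have h2 := h.right
  have := h.of_adj _ _ hc
  by_cases hvb : S.Adj v b
  · rw [hF.swap]
    exact h.cross_eq_zero hF hvb hc
  · apply hF.eq_zero_of_nonadj
    · intro hh
      exact hbv (h.eq_of_map_eq hh (by omega) (by omega))
    · intro hh
      have := (h.eq_iff _ _).1 hh
      grind
    · intro hh
      exact hvb (h.adj_of_adj_map hh (by omega) (by omega)).symm
    · intro hh
      obtain ⟨x, y, hx, hy, hxy⟩ := (h.adj_iff _ _).1 hh
      have := h.of_adj _ _ hxy
      rw [h.eq_iff] at hx hy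
      grind

-- The generators are pushed forward along `π`, but only if `c` is on or next to the edge. The
-- restriction is needed: (vb, w) vanishes in `S`, whereas its naive image is (vb, v). Each relation
-- of `S` then becomes a relation of `T` up to terms that vanish.
open Classical in
theorem isEdgeVertexFun_push (h : FarIdentification S T π v w δ) {M : Type*} [AddCommGroup M]
    {F : W → W → W → M} (hF : IsEdgeVertexFun T F) :
    IsEdgeVertexFun S fun a b c =>
      if S.Adj a b ∧ (c = a ∨ c = b ∨ S.Adj c a ∨ S.Adj c b) then F (π a) (π b) (π c) else 0 := by
  constructor
  · intro a b c
    simp only [hF.swap (π a), S.adj_comm a b]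
    congr 1
    grind
  · intro a b c hab
    simp [hab]
  · intro a b
    simp [hF.ends (π a)]
  · intro a b c hab hbc hca
    -- With at most one edge among the three vertices all terms are 0 by definition. Otherwise the
    -- vertices are within distance 2 of each other, where `π` preserves and reflects adjacency.
    by_cases hfew : (¬ S.Adj a b ∧ ¬ S.Adj b c) ∨ (¬ S.Adj b c ∧ ¬ S.Adj c a) ∨
        (¬ S.Adj c a ∧ ¬ S.Adj a b)
    · have := S.adj_comm a b
      have := S.adj_comm b c
      have := S.adj_comm c a
      grind
    · have hlip : δ a ≤ δ b + 2 ∧ δ b ≤ δ a + 2 ∧ δ a ≤ δ c + 2 ∧ δ c ≤ δ a + 2 ∧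
          δ c ≤ δ b + 2 ∧ δ b ≤ δ c + 2 := by
        have := h.of_adj a b
        have := h.of_adj b c
        have := h.of_adj c a
        grind
      have key : ∀ x y z, S.Adj x z ∨ S.Adj y z → δ x ≤ δ y + 2 → δ y ≤ δ x + 2 →
          (if S.Adj x y ∧ (z = x ∨ z = y ∨ S.Adj z x ∨ S.Adj z y) then F (π x) (π y) (π z)
            else 0) = F (π x) (π y) (π z) := by
        intro x y z hz h1 h2
        by_cases hxy : S.Adj x y
        · rw [if_pos]
          have := S.adj_comm x z
          have := S.adj_comm y z
          tauto
        · rw [if_neg (by tauto), hF.nonadj]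
          exact fun hh => hxy (h.adj_of_adj_map hh (by omega) (by omega))
      have := S.adj_comm a b
      have := S.adj_comm b c
      have := S.adj_comm c a
      rw [key a b c (by tauto) (by omega) (by omega), key b c a (by tauto) (by omega) (by omega),
        key c a b (by tauto) (by omega) (by omega)]
      apply hF.triple
      · exact fun hh => hab (h.eq_of_map_eq hh (by omega) (by omega))
      · exact fun hh => hbc (h.eq_of_map_eq hh (by omega) (by omega))
      · exact fun hh => hca (h.eq_of_map_eq hh (by omega) (by omega))
  · intro a b hab
    by_cases hnear : S.Adj a b ∨ ∃ c, S.Adj a c ∧ S.Adj c b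
    · have hlip : δ a ≤ δ b + 2 ∧ δ b ≤ δ a + 2 := by
        rcases hnear with hh | ⟨c, hh, hh'⟩
        · have := h.of_adj _ _ hh
          grind
        · have := h.of_adj _ _ hh
          have := h.of_adj _ _ hh'
          grind
      have hl := h.left
      have hr := h.right
      refine Eq.trans ?_ (hF.star (π a) (π b) fun hh =>
        hab (h.eq_of_map_eq hh (by omega) (by omega)))
      -- The star sum in `S` is compared with the one in `T`, one vertex `y` of `T` at a time.
      rw [← Finset.sum_fiberwise Finset.univ π]
      refine Finset.sum_congr rfl fun y _ => ?_
      by_cases hy : ∃ c, π c = y ∧ S.Adj a c ∧ (b = a ∨ b = c ∨ S.Adj b a ∨ S.Adj b c)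
      · obtain ⟨c, rfl, hc⟩ := hy
        rw [Finset.sum_eq_single c, if_pos hc]
        · intro d hd hdc
          rw [if_neg]
          rintro ⟨had, -⟩
          have := h.of_adj _ _ had
          have := h.of_adj _ _ hc.1
          exact hdc (h.eq_of_map_eq (Finset.mem_filter.1 hd).2 (by omega) (by omega))
        · simp
      · rw [Finset.sum_eq_zero fun c hc => if_neg fun hh => hy ⟨c, (Finset.mem_filter.1 hc).2, hh⟩]
        symm
        by_cases hay : T.Adj (π a) y
        · obtain ⟨x, z, hx, rfl, hxz⟩ := (h.adj_iff _ _).1 hay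
          have := h.of_adj _ _ hxz
          obtain rfl | ⟨rfl, rfl⟩ | ⟨rfl, rfl⟩ := (h.eq_iff _ _).1 hx
          · have hz : ¬ (b = x ∨ b = z ∨ S.Adj b x ∨ S.Adj b z) := fun hh => hy ⟨z, rfl, hxz, hh⟩
            apply hF.eq_zero_of_nonadj
            · exact fun hh => hab (h.eq_of_map_eq hh (by omega) (by omega)).symm
            · exact fun hh => hz (.inr (.inl (h.eq_of_map_eq hh (by omega) (by omega))))
            · exact fun hh => hz
                (.inr (.inr (.inl (h.adj_of_adj_map hh (by omega) (by omega)))))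
            · exact fun hh => hz
                (.inr (.inr (.inr (h.adj_of_adj_map hh (by omega) (by omega)))))
          -- Here `a` is one of the two identified vertices and `y` comes from a neighbour of the
          -- other.
          · exact h.symm.cross_eq_zero' hF hab.symm (by omega) (by omega) hxz.symm
          · exact h.cross_eq_zero' hF hab.symm (by omega) (by omega) hxz.symm
        · exact hF.nonadj _ _ _ hay
    · refine Finset.sum_eq_zero fun c _ => if_neg ?_
      rintro ⟨h1, h2⟩
      have := S.adj_comm a b
      have := S.adj_comm b c
      grind

-- Here `d` and `b` are neighbours of different preimages of the glued vertex, the situation of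
-- `cross_eq_zero`.
omit [Fintype V] in
theorem shifted_vertex_eq_zero (h : FarIdentification S T π v w δ) {M : Type*} [AddCommGroup M]
    {F : W → W → W → M} (hF : IsEdgeVertexFun T F) {a a' b d : V} (hab : S.Adj a b)
    (ha : π a' = π a) (hne : a' ≠ a) (hd : S.Adj d a') : F (π a) (π b) (π d) = 0 := by
  rw [hF.swap]
  obtain hh | ⟨rfl, rfl⟩ | ⟨rfl, rfl⟩ := (h.eq_iff _ _).1 ha
  · exact absurd hh hne
  · rw [← ha]
    exact h.cross_eq_zero hF hd.symm hab.symm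
  · rw [← ha]
    exact h.symm.cross_eq_zero hF hd.symm hab.symm

-- The vertices `c` and `d` are `v` and `w` in some order. As `d` is on or next to the edge `ab`,
-- its twin `c` is neither on the edge nor adjacent to it.
omit [Fintype W] in
theorem fiber_vertex_eq_zero (h : FarIdentification S T π v w δ) {M : Type*} [AddCommGroup M]
    {F : V → V → V → M} (hF : IsEdgeVertexFun S F) {a b c d : V} (hcd : c ≠ d) (hπ : π c = π d)
    (hd : d = a ∨ d = b ∨ S.Adj d a ∨ S.Adj d b) : F a b c = 0 := by
  have h1 := h.left
  have h2 := h.right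
  have := (h.eq_iff _ _).1 hπ
  by_cases hab : S.Adj a b
  · have := h.of_adj _ _ hab
    have := h.of_adj d a
    have := h.of_adj d b
    have := h.of_adj c a
    have := h.of_adj c b
    apply hF.eq_zero_of_nonadj <;> grind
  · exact hF.nonadj _ _ _ hab

-- Summing over all preimages handles the glued vertex without choices. Most relations hold term by
-- term; `ends` needs `fiber_vertex_eq_zero` to discard the wrong preimage.
open Classical in
theorem isEdgeVertexFun_pull (h : FarIdentification S T π v w δ) {M : Type*} [AddCommGroup M]
    {F : V → V → V → M} (hF : IsEdgeVertexFun S F) :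
    IsEdgeVertexFun T fun x y z => ∑ a with π a = x, ∑ b with π b = y, ∑ c with π c = z, F a b c := by
  constructor
  · intro x y z
    rw [Finset.sum_comm]
    simp only [hF.swap]
  · intro x y z hxy
    refine Finset.sum_eq_zero fun a ha => Finset.sum_eq_zero fun b hb =>
      Finset.sum_eq_zero fun c hc => hF.nonadj _ _ _ fun hab => hxy ?_
    rw [← (Finset.mem_filter.1 ha).2, ← (Finset.mem_filter.1 hb).2]
    exact h.adj_map hab
  · intro x y
    refine Finset.sum_congr rfl fun a ha => Finset.sum_congr rfl fun b hb => ?_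
    simp only [Finset.mem_filter, Finset.mem_univ, true_and] at ha hb
    rw [Finset.sum_eq_single a, Finset.sum_eq_single b, hF.ends]
    · intro c hc hcb
      exact h.fiber_vertex_eq_zero hF hcb ((Finset.mem_filter.1 hc).2.trans hb.symm) (by simp)
    · simp [hb]
    · intro c hc hca
      exact h.fiber_vertex_eq_zero hF hca ((Finset.mem_filter.1 hc).2.trans ha.symm) (by simp)
    · simp [ha]
  · intro x y z hxy hyz hzx
    have h2 : ∑ b with π b = y, ∑ c with π c = z, ∑ a with π a = x, F b c a =
        ∑ a with π a = x, ∑ b with π b = y, ∑ c with π c = z, F b c a := by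
      rw [Finset.sum_comm (s := Finset.univ.filter fun a => π a = x)]
      exact Finset.sum_congr rfl fun b _ => Finset.sum_comm
    have h3 : ∑ c with π c = z, ∑ a with π a = x, ∑ b with π b = y, F c a b =
        ∑ a with π a = x, ∑ b with π b = y, ∑ c with π c = z, F c a b := by
      rw [Finset.sum_comm]
      exact Finset.sum_congr rfl fun a _ => Finset.sum_comm
    simp only [h2, h3, ← Finset.sum_add_distrib]
    refine Finset.sum_eq_zero fun a ha => Finset.sum_eq_zero fun b hb =>
      Finset.sum_eq_zero fun c hc => hF.triple _ _ _ ?_ ?_ ?_ <;> grind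
  · intro x z hxz
    rw [Finset.sum_comm]
    refine Finset.sum_eq_zero fun a ha => ?_
    rw [Finset.sum_fiberwise Finset.univ π fun b => ∑ c with π c = z, F a b c, Finset.sum_comm]
    refine Finset.sum_eq_zero fun c hc => hF.star _ _ ?_
    grind

/-- Identifying two vertices whose distance is greater than `4` does not change the group of
edge-vertex pairs. -/
theorem nonempty_equiv (h : FarIdentification S T π v w δ) :
    Nonempty (EdgeVertexGroup T ≃ₗ[ℤ] EdgeVertexGroup S) := by
  classical
  have hS := isEdgeVertexFun_of S
  have hT := isEdgeVertexFun_of T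
  have h1 := h.left
  have h2 := h.right
  set f := lift _ (h.isEdgeVertexFun_push hT) with hf
  set g := lift _ (h.isEdgeVertexFun_pull hS) with hg
  -- A left inverse and surjectivity of `f` suffice; the other composite is not computed.
  have hgf : g ∘ₗ f = LinearMap.id := by
    apply hom_ext
    intro a b c
    simp only [hf, hg, LinearMap.comp_apply, lift_of, LinearMap.id_apply]
    split_ifs with hc
    · rw [lift_of, Finset.sum_eq_single a, Finset.sum_eq_single b, Finset.sum_eq_single c]
      · intro d hd hdc
        exact h.fiber_vertex_eq_zero hS hdc (Finset.mem_filter.1 hd).2 hc.2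
      · simp
      · intro d hd hdb
        refine Finset.sum_eq_zero fun c' _ => hS.nonadj _ _ _ fun hh => ?_
        have := h.of_adj _ _ hh
        have := h.of_adj _ _ hc.1
        exact hdb (h.eq_of_map_eq (Finset.mem_filter.1 hd).2 (by omega) (by omega))
      · simp
      · intro d hd hda
        refine Finset.sum_eq_zero fun b' hb' => Finset.sum_eq_zero fun c' _ =>
          hS.nonadj _ _ _ fun hh => ?_
        have := h.of_adj _ _ hh
        have := h.of_adj _ _ hc.1
        have := (h.eq_iff _ _).1 (Finset.mem_filter.1 hd).2
        have := (h.eq_iff _ _).1 (Finset.mem_filter.1 hb').2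
        grind
      · simp
    · rw [map_zero]
      by_cases hab : S.Adj a b
      · exact (hS.eq_zero_of_nonadj (by tauto) (by tauto) (by tauto) (by tauto)).symm
      · exact (hS.nonadj _ _ _ hab).symm
  have hsurj : Function.Surjective f := by
    rw [← LinearMap.range_eq_top]
    apply range_eq_top
    intro x y z
    by_cases hxy : T.Adj x y
    · obtain ⟨a, b, rfl, rfl, hab⟩ := (h.adj_iff _ _).1 hxy
      by_cases hz : ∃ c, π c = z ∧ (c = a ∨ c = b ∨ S.Adj c a ∨ S.Adj c b)
      · obtain ⟨c, rfl, hc⟩ := hz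
        exact ⟨of S a b c, by rw [hf, lift_of, if_pos ⟨hab, hc⟩]⟩
      · suffices of T (π a) (π b) z = 0 by rw [this]; exact zero_mem _
        obtain ⟨c, rfl⟩ := h.surj z
        have := h.of_adj _ _ hab
        -- No preimage of `z` is near the edge `ab`, so if `z` is adjacent to an end in `T`, that
        -- adjacency comes from the other preimage of this end.
        by_cases hnear : T.Adj (π c) (π a) ∨ T.Adj (π c) (π b)
        · have : (∃ d, π d = π c ∧ ∃ a', π a' = π a ∧ a' ≠ a ∧ S.Adj d a') ∨
              (∃ d, π d = π c ∧ ∃ b', π b' = π b ∧ b' ≠ b ∧ S.Adj d b') := by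
            rcases hnear with hh | hh
            · obtain ⟨d, a', hd, ha', hda⟩ := (h.adj_iff _ _).1 hh
              exact .inl ⟨d, hd, a', ha', by grind, hda⟩
            · obtain ⟨d, b', hd, hb', hdb⟩ := (h.adj_iff _ _).1 hh
              exact .inr ⟨d, hd, b', hb', by grind, hdb⟩
          rcases this with ⟨d, hd, a', ha', hne, hda⟩ | ⟨d, hd, b', hb', hne, hdb⟩
          · rw [← hd]
            exact h.shifted_vertex_eq_zero hT hab ha' hne hda
          · rw [← hd, hT.swap]
            exact h.shifted_vertex_eq_zero hT hab.symm hb' hne hdb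
        · exact hT.eq_zero_of_nonadj (fun hh => hz ⟨a, hh.symm, by simp⟩)
            (fun hh => hz ⟨b, hh.symm, by simp⟩) (by tauto) (by tauto)
    · rw [hT.nonadj _ _ _ hxy]
      exact zero_mem _
  have hinj : Function.Injective f :=
    Function.LeftInverse.injective (g := g) fun x => LinearMap.congr_fun hgf x
  exact ⟨(LinearEquiv.ofBijective f ⟨hinj, hsurj⟩).symm⟩

end FarIdentification

end EdgeVertexGroup

/-! ### Whitney flips -/

/-- The data of a Whitney flip from the simple graph `S` to `S'`: the vertex sets `A` and
`(A ∪ {p, q})ᶜ` are separated by `p`, `q`, and the side of `A` is reattached with `p` and `q`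
exchanged. -/
structure SimpleWhitneyFlip {V : Type*} [DecidableEq V] (S S' : SimpleGraph V) (A : Set V)
    (p q : V) : Prop where
  left : p ∉ A
  right : q ∉ A
  ne : p ≠ q
  sep : ∀ a b, a ∈ A → b ∉ A → b ≠ p → b ≠ q → ¬ S.Adj a b
  inside : ∀ a b, a ∈ A ∨ b ∈ A → (S'.Adj a b ↔ S.Adj (Equiv.swap p q a) (Equiv.swap p q b))
  outside : ∀ a b, a ∉ A → b ∉ A → (S'.Adj a b ↔ S.Adj a b)

namespace SimpleWhitneyFlip

section

variable {V : Type*} [DecidableEq V] {S S' : SimpleGraph V} {A : Set V} {p q : V}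

theorem swap_of_mem (h : SimpleWhitneyFlip S S' A p q) {a : V} (ha : a ∈ A) :
    Equiv.swap p q a = a :=
  Equiv.swap_apply_of_ne_of_ne (fun hh => h.left (hh ▸ ha)) fun hh => h.right (hh ▸ ha)

theorem swap_mem_iff (h : SimpleWhitneyFlip S S' A p q) {a : V} :
    Equiv.swap p q a ∈ A ↔ a ∈ A := by
  have h1 := h.left
  have h2 := h.right
  rw [Equiv.swap_apply_def]
  split_ifs <;> simp_all

theorem symm (h : SimpleWhitneyFlip S S' A p q) : SimpleWhitneyFlip S' S A p q where
  left := h.left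
  right := h.right
  ne := h.ne
  sep a b ha hb hbp hbq := by
    rw [h.inside a b (.inl ha), h.swap_of_mem ha, Equiv.swap_apply_of_ne_of_ne hbp hbq]
    exact h.sep a b ha hb hbp hbq
  inside a b hab := by
    rw [h.inside _ _ (by rwa [h.swap_mem_iff, h.swap_mem_iff]), Equiv.swap_apply_self,
      Equiv.swap_apply_self]
  outside a b ha hb := (h.outside a b ha hb).symm

theorem comm (h : SimpleWhitneyFlip S S' A p q) : SimpleWhitneyFlip S S' A q p where
  left := h.right
  right := h.left
  ne := h.ne.symm
  sep a b ha hb hbp hbq := h.sep a b ha hb hbq hbp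
  inside := by simpa only [Equiv.swap_comm q p] using h.inside
  outside := h.outside

end

variable {V : Type*} [Fintype V] [DecidableEq V] {S S' : SimpleGraph V} {A : Set V} {p q : V}

/-- The two edges that join a vertex on one side to `p` and `q` are opposite on the vertices of
the other side. -/
theorem cross (h : SimpleWhitneyFlip S S' A p q) {M : Type*} [AddCommGroup M]
    {F : V → V → V → M} (hF : IsEdgeVertexFun S F) {a b : V} (hap : a ≠ p) (haq : a ≠ q)
    (hbp : b ≠ p) (hbq : b ≠ q) (hab : a ∈ A ↔ b ∉ A) : F p a b + F q a b = 0 := by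
  have key : ∀ x y, x ≠ p → x ≠ q → y ≠ p → y ≠ q → (x ∈ A ↔ y ∉ A) → ¬ S.Adj x y := by
    intro x y hx hx' hy hy' hxy hh
    by_cases hxA : x ∈ A
    · exact h.sep x y hxA (hxy.1 hxA) hy hy' hh
    · exact h.sep y x (by tauto) hxA hx hx' hh.symm
  have hne : a ≠ b := by
    rintro rfl
    tauto
  rw [hF.swap p, hF.swap q, ← hF.star a b hne, eq_comm]
  -- In the star relation at `a`, `b` only `p` and `q` can be common neighbours of two vertices on
  -- opposite sides.
  apply Fintype.sum_eq_add p q h.ne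
  rintro d ⟨hdp, hdq⟩
  by_cases hd : d ∈ A ↔ b ∈ A
  · exact hF.nonadj _ _ _ (key a d hap haq hdp hdq (by tauto))
  · apply hF.eq_zero_of_nonadj hne.symm (fun hh => hd (by rw [hh]))
    · exact key b a hbp hbq hap haq (by tauto)
    · exact key b d hbp hbq hdp hdq (by tauto)

open Classical in
/-- The correction of the flip map at the edge `pq`. -/
noncomputable def corr (A : Set V) (p q : V) {M : Type*} [AddCommGroup M] (F : V → V → V → M)
    (c : V) : M :=
  if c ∈ A then -(2 : ℤ) • F p q c else if c = p ∨ c = q then -∑ g with g ∈ A, F p q g else 0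

open Classical in
/-- The effect of a Whitney flip on pairs of an edge and a vertex. -/
noncomputable def flipFun (A : Set V) (p q : V) {M : Type*} [AddCommGroup M] (F : V → V → V → M)
    (a b c : V) : M :=
  if a ∈ A ∨ b ∈ A then -F (Equiv.swap p q a) (Equiv.swap p q b) (Equiv.swap p q c)
  else F a b c + if s(a, b) = s(p, q) then corr A p q F c else 0

variable {M : Type*} [AddCommGroup M] {F : V → V → V → M}

theorem flipFun_comm (hF : IsEdgeVertexFun S' F) : flipFun A p q F = flipFun A q p F := by
  have : corr A p q F = corr A q p F := by
    funext c
    simp only [corr, hF.swap p q, or_comm]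
  funext a b c
  simp only [flipFun, this, Equiv.swap_comm p q, Sym2.eq_swap (a := p) (b := q)]

theorem flipFun_of_mem {a b c : V} (hab : a ∈ A ∨ b ∈ A) : flipFun A p q F a b c =
    -F (Equiv.swap p q a) (Equiv.swap p q b) (Equiv.swap p q c) := if_pos hab

theorem flipFun_of_notMem {a b c : V} (ha : a ∉ A) (hb : b ∉ A) (hab : s(a, b) ≠ s(p, q)) :
    flipFun A p q F a b c = F a b c := by
  rw [flipFun, if_neg (by tauto), if_neg hab, add_zero]

theorem flipFun_left_right (h : SimpleWhitneyFlip S S' A p q) (c : V) :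
    flipFun A p q F p q c = F p q c + corr A p q F c := by
  rw [flipFun, if_neg (by simp [h.left, h.right]), if_pos rfl]

theorem flipFun_swap (hF : IsEdgeVertexFun S' F) (a b c : V) :
    flipFun A p q F a b c = flipFun A p q F b a c := by
  by_cases hA : a ∈ A ∨ b ∈ A
  · rw [flipFun_of_mem hA, flipFun_of_mem hA.symm, hF.swap]
  · rw [flipFun, flipFun, if_neg hA, if_neg (mt Or.symm hA), hF.swap a, Sym2.eq_swap]

/-- Since `ab` is not an edge, the triple relation has two terms left. If `c` is `p` or `q`, the
flip replaces one of them by minus the term with `p` and `q` exchanged, which is equal to it by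
`cross`. -/
theorem flipFun_triple_of_ne (h : SimpleWhitneyFlip S S' A p q) (hF : IsEdgeVertexFun S' F)
    {a b c : V} (ha : a ∈ A) (hb : b ∉ A) (hbp : b ≠ p) (hbq : b ≠ q) (hc : c ∉ A) (hbc : b ≠ c) :
    flipFun A p q F a b c + flipFun A p q F b c a + flipFun A p q F c a b = 0 := by
  have hab : ¬ S'.Adj a b := h.symm.sep a b ha hb hbp hbq
  have hap : a ≠ p := fun hh => h.left (hh ▸ ha)
  have haq : a ≠ q := fun hh => h.right (hh ▸ ha)
  have hne : a ≠ b := fun hh => hb (hh ▸ ha)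
  have hca : c ≠ a := fun hh => hc (hh ▸ ha)
  have hbcpq : s(b, c) ≠ s(p, q) := by
    rw [Ne, Sym2.eq_iff]
    tauto
  have hcross := h.symm.cross hF hap haq hbp hbq (by tauto)
  have htriple := hF.triple a b c hne hbc hca
  rw [flipFun_of_mem (.inl ha), flipFun_of_mem (.inr ha), flipFun_of_notMem hb hc hbcpq,
    h.swap_of_mem ha, Equiv.swap_apply_of_ne_of_ne hbp hbq, hF.nonadj a b _ hab, neg_zero, zero_add]
  rw [hF.nonadj a b _ hab, zero_add] at htriple
  rcases eq_or_ne c p with rfl | hcp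
  · rw [Equiv.swap_apply_left, eq_neg_of_add_eq_zero_left htriple,
      eq_neg_of_add_eq_zero_left hcross]
    abel
  rcases eq_or_ne c q with rfl | hcq
  · rw [Equiv.swap_apply_right, eq_neg_of_add_eq_zero_left htriple,
      eq_neg_of_add_eq_zero_left hcross]
    abel
  · have hac : ¬ S'.Adj c a := fun hh => h.symm.sep a c ha hc hcp hcq hh.symm
    rw [hF.nonadj c a _ hac, add_zero] at htriple
    rw [htriple, Equiv.swap_apply_of_ne_of_ne hcp hcq, hF.nonadj c a _ hac, neg_zero, zero_add]

/-- The new case is {b, c} = {p, q}. There the correction −2(pq, a) turns (pq, a) into its negative,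
so that all three terms change sign and the triple relation survives. -/
theorem flipFun_triple (h : SimpleWhitneyFlip S S' A p q) (hF : IsEdgeVertexFun S' F) {a b c : V}
    (ha : a ∈ A) (hb : b ∉ A) (hc : c ∉ A) (hbc : b ≠ c) :
    flipFun A p q F a b c + flipFun A p q F b c a + flipFun A p q F c a b = 0 := by
  have hcomm : ∀ {x y : V}, x ∉ A → y ∉ A → x ≠ p → x ≠ q → x ≠ y →
      flipFun A p q F a x y + flipFun A p q F x y a + flipFun A p q F y a x = 0 :=
    fun hx hy hxp hxq hxy => flipFun_triple_of_ne h hF ha hx hxp hxq hy hxy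
  have hpq : ∀ {x y : V}, x = p → y = q →
      flipFun A p q F a x y + flipFun A p q F x y a + flipFun A p q F y a x = 0 := by
    rintro x y rfl rfl
    have htriple := hF.triple a y x (fun hh => h.right (hh ▸ ha)) h.ne.symm
      (fun hh => h.left (hh ▸ ha))
    rw [flipFun_of_mem (.inl ha), flipFun_of_mem (.inr ha), flipFun_left_right h, corr, if_pos ha,
      h.swap_of_mem ha, Equiv.swap_apply_left, Equiv.swap_apply_right, hF.swap x y a,
      ← neg_eq_zero, ← htriple]
    module
  have hswap : flipFun A p q F a b c + flipFun A p q F b c a + flipFun A p q F c a b =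
      flipFun A p q F a c b + flipFun A p q F c b a + flipFun A p q F b a c := by
    rw [flipFun_swap hF a b, flipFun_swap hF b c, flipFun_swap hF c a]
    abel
  by_cases hb' : b ≠ p ∧ b ≠ q
  · exact hcomm hb hc hb'.1 hb'.2 hbc
  by_cases hc' : c ≠ p ∧ c ≠ q
  · rw [hswap]
    exact hcomm hc hb hc'.1 hc'.2 hbc.symm
  by_cases hbp : b = p
  · exact hpq hbp (by grind)
  · rw [hswap]
    exact hpq (by grind) (by grind)

/-- The origin of `corr`. For `b` in `A`, the star relation at `q` turns the defect into the sum of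
(pc, b) + (qc, b) over `c` outside `A`, which `cross` reduces to 2(pq, b). For `b = q`, the triple
relations reduce the defect to the sum of (pq, g) over `g` in `A`. For any other `b` it is zero by
`cross`. -/
theorem flipFun_star_left (h : SimpleWhitneyFlip S S' A p q) (hF : IsEdgeVertexFun S' F) {b : V}
    (hb : p ≠ b) : ∑ c, flipFun A p q F p c b = 0 := by
  classical
  have h1 : ∑ c with c ∈ A, flipFun A p q F p c b =
      -∑ c with c ∈ A, F q c (Equiv.swap p q b) := by
    rw [← Finset.sum_neg_distrib]
    refine Finset.sum_congr rfl fun c hc => ?_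
    rw [flipFun_of_mem (.inr (Finset.mem_filter.1 hc).2), h.swap_of_mem (Finset.mem_filter.1 hc).2,
      Equiv.swap_apply_left]
  have h2 : ∑ c with c ∉ A, flipFun A p q F p c b =
      ∑ c with c ∉ A, F p c b + corr A p q F b := by
    have : ∑ c with c ∉ A, (if c = q then corr A p q F b else 0) = corr A p q F b := by
      rw [Finset.sum_ite_eq' _ q, if_pos]
      simpa using h.right
    rw [← this]
    rw [← Finset.sum_add_distrib]
    refine Finset.sum_congr rfl fun c hc => ?_
    rw [flipFun, if_neg (by simpa [h.left] using hc)]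
    simp [h.ne]
  rw [← Finset.sum_filter_add_sum_filter_not _ (· ∈ A), h1, h2]
  have hp := hF.star p b hb
  rw [← Finset.sum_filter_add_sum_filter_not _ (· ∈ A)] at hp
  by_cases hbA : b ∈ A
  · have hbq : q ≠ b := fun hh => h.right (hh ▸ hbA)
    have hq := hF.star q b hbq
    rw [← Finset.sum_filter_add_sum_filter_not _ (· ∈ A)] at hq
    have hsum : ∑ c with c ∉ A, (F p c b + F q c b) = (F p p b + F q p b) + (F p q b + F q q b) := by
      refine Eq.trans ?_ (Finset.sum_pair (f := fun c => F p c b + F q c b) h.ne)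
      symm
      apply Finset.sum_subset
      · simp [Finset.insert_subset_iff, h.left, h.right]
      · intro c hc hc'
        have : c ∉ A := by simpa using hc
        have : c ≠ p ∧ c ≠ q := by simpa using hc'
        exact h.symm.cross hF this.1 this.2 hb.symm hbq.symm (by tauto)
    rw [hF.nonadj p p b (by simp), hF.nonadj q q b (by simp), hF.swap q p,
      Finset.sum_add_distrib] at hsum
    rw [h.swap_of_mem hbA, corr, if_pos hbA, eq_neg_of_add_eq_zero_left hq, neg_neg,
      ← add_assoc, add_comm (∑ c with c ∉ A, F q c b), hsum]
    module
  rw [eq_neg_of_add_eq_zero_right hp]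
  by_cases hbq : b = q
  · subst hbq
    rw [Equiv.swap_apply_right, corr, if_neg hbA, if_pos (.inr rfl), ← neg_add, ← neg_add,
      neg_eq_zero, ← Finset.sum_add_distrib, ← Finset.sum_add_distrib]
    refine Finset.sum_eq_zero fun c hc => ?_
    have hc := (Finset.mem_filter.1 hc).2
    rw [← hF.triple p c b (fun hh => h.left (hh ▸ hc)) (fun hh => h.right (hh ▸ hc)) h.ne.symm,
      hF.swap b c, hF.swap p b]
    abel
  · rw [Equiv.swap_apply_of_ne_of_ne hb.symm hbq, corr, if_neg hbA, if_neg (by tauto), add_zero,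
      ← neg_add, neg_eq_zero, ← Finset.sum_add_distrib]
    refine Finset.sum_eq_zero fun c hc => ?_
    have hc := (Finset.mem_filter.1 hc).2
    rw [add_comm]
    exact h.symm.cross hF (fun hh => h.left (hh ▸ hc)) (fun hh => h.right (hh ▸ hc)) hb.symm hbq
      (by tauto)

theorem isEdgeVertexFun_flipFun (h : SimpleWhitneyFlip S S' A p q) (hF : IsEdgeVertexFun S' F) :
    IsEdgeVertexFun S (flipFun A p q F) := by
  constructor
  · exact flipFun_swap hF
  · intro a b c hab
    by_cases hA : a ∈ A ∨ b ∈ A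
    · rw [flipFun_of_mem hA, hF.nonadj, neg_zero]
      rwa [← h.symm.inside a b hA]
    · rw [not_or] at hA
      have hab' : ¬ S'.Adj a b := by rwa [h.outside a b hA.1 hA.2]
      by_cases hpq : s(a, b) = s(p, q)
      · have : ∀ c, F p q c = 0 := by
          intro c
          apply hF.nonadj
          rwa [← SimpleGraph.mem_edgeSet, ← hpq]
        simp [flipFun, hA, hpq, corr, this, hF.nonadj a b c hab']
      · rw [flipFun_of_notMem hA.1 hA.2 hpq, hF.nonadj a b c hab']
  · intro a b
    by_cases hA : a ∈ A ∨ b ∈ A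
    · rw [flipFun_of_mem hA, flipFun_of_mem hA, hF.ends]
    · have : s(a, b) = s(p, q) → corr A p q F a = corr A p q F b := by
        intro hh
        rw [not_or] at hA
        rcases Sym2.eq_iff.1 hh with ⟨rfl, rfl⟩ | ⟨rfl, rfl⟩ <;> simp [corr, hA]
      rw [flipFun, flipFun, if_neg hA, if_neg hA, hF.ends]
      split_ifs with hh
      · rw [this hh]
      · rfl
  · intro a b c hab hbc hca
    have hτ := (Equiv.swap p q).injective
    have rot : ∀ x y z : M, x + y + z = y + z + x := fun x y z => by abel
    -- With two vertices in `A` all three pairs meet `A`, so the whole relation is negated and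
    -- transported by the swap.
    by_cases htwo : (a ∈ A ∧ b ∈ A) ∨ (b ∈ A ∧ c ∈ A) ∨ (c ∈ A ∧ a ∈ A)
    · rw [flipFun_of_mem (by tauto), flipFun_of_mem (by tauto), flipFun_of_mem (by tauto)]
      simpa [← neg_add, -neg_add_rev] using
        hF.triple _ _ _ (hτ.ne hab) (hτ.ne hbc) (hτ.ne hca)
    by_cases ha : a ∈ A
    · exact flipFun_triple h hF ha (by tauto) (by tauto) hbc
    by_cases hb : b ∈ A
    · rw [rot]
      exact flipFun_triple h hF hb (by tauto) ha hca
    by_cases hc : c ∈ A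
    · rw [← rot]
      exact flipFun_triple h hF hc ha hb hab
    -- Outside `A` the correction is supported on the ends `p`, `q` of the edge, hence is invisible
    -- at a third vertex.
    have key : ∀ x y z, x ∉ A → y ∉ A → z ∉ A → z ≠ x → z ≠ y →
        flipFun A p q F x y z = F x y z := by
      intro x y z hx hy hz hzx hzy
      by_cases hpq : s(x, y) = s(p, q)
      · have : z ≠ p ∧ z ≠ q := by grind [Sym2.eq_iff]
        simp [flipFun, hx, hy, hpq, corr, hz, this]
      · exact flipFun_of_notMem hx hy hpq
    rw [key a b c ha hb hc hca hbc.symm, key b c a hb hc ha hab hca.symm,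
      key c a b hc ha hb hbc hab.symm, hF.triple a b c hab hbc hca]
  · intro a b hab
    by_cases ha : a ∈ A
    · simp_rw [flipFun_of_mem (F := F) (p := p) (q := q) (A := A) (a := a) (.inl ha)]
      rw [Finset.sum_neg_distrib, Equiv.sum_comp (Equiv.swap p q) fun c => F _ c _, hF.star,
        neg_zero]
      exact (Equiv.swap p q).injective.ne hab
    · by_cases hap : a = p
      · subst hap
        exact flipFun_star_left h hF hab
      by_cases haq : a = q
      · subst haq
        rw [flipFun_comm hF]
        exact flipFun_star_left h.comm hF hab
      rw [← hF.star a b hab]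
      refine Finset.sum_congr rfl fun c _ => ?_
      by_cases hc : c ∈ A
      · rw [flipFun_of_mem (.inr hc), Equiv.swap_apply_of_ne_of_ne hap haq, h.swap_of_mem hc]
        have : ¬ S'.Adj a c := fun hh => h.symm.sep c a hc ha hap haq hh.symm
        rw [hF.nonadj _ _ _ this, hF.nonadj _ _ _ this, neg_zero]
      · apply flipFun_of_notMem ha hc
        rw [Ne, Sym2.eq_iff]
        tauto

open EdgeVertexGroup

-- Away from `pq` the signs and swaps cancel. At `pq`, generators with a vertex in `A` are negated
-- by each flip, so the sum over `A` subtracted at `p` and `q` by the first flip comes back with the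
-- opposite sign and cancels that of the second.
open Classical in
theorem lift_comp_lift (h : SimpleWhitneyFlip S S' A p q) :
    lift _ (h.symm.isEdgeVertexFun_flipFun (isEdgeVertexFun_of S)) ∘ₗ
      lift _ (h.isEdgeVertexFun_flipFun (isEdgeVertexFun_of S')) = LinearMap.id := by
  apply hom_ext
  intro a b c
  rw [LinearMap.comp_apply, lift_of, LinearMap.id_apply]
  by_cases hA : a ∈ A ∨ b ∈ A
  · rw [flipFun_of_mem hA, map_neg, lift_of, flipFun_of_mem (by simpa [h.swap_mem_iff] using hA)]
    simp
  · by_cases hpq : s(a, b) = s(p, q)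
    · have : of S a b c = of S p q c ∧ flipFun A p q (of S') a b c = flipFun A p q (of S') p q c := by
        rcases Sym2.eq_iff.1 hpq with ⟨rfl, rfl⟩ | ⟨rfl, rfl⟩
        · exact ⟨rfl, rfl⟩
        · exact ⟨(isEdgeVertexFun_of S).swap _ _ _, flipFun_swap (isEdgeVertexFun_of S') _ _ _⟩
      rw [this.1, this.2, flipFun_left_right h, map_add, lift_of, flipFun_left_right h.symm]
      have hg : ∀ g ∈ A, lift _ (h.symm.isEdgeVertexFun_flipFun (isEdgeVertexFun_of S))
          (of S' p q g) = -of S p q g := by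
        intro g hg
        rw [lift_of, flipFun_left_right h.symm, corr, if_pos hg]
        module
      by_cases hc : c ∈ A
      · rw [corr, corr, if_pos hc, if_pos hc, map_zsmul, hg c hc]
        module
      · rw [corr, corr, if_neg hc, if_neg hc]
        split_ifs
        · rw [map_neg, map_sum, Finset.sum_congr rfl fun g hg' => hg g (Finset.mem_filter.1 hg').2,
            Finset.sum_neg_distrib]
          abel
        · simp
    · rw [not_or] at hA
      rw [flipFun_of_notMem hA.1 hA.2 hpq, lift_of, flipFun_of_notMem hA.1 hA.2 hpq]

/-- The group of edge-vertex pairs is invariant under Whitney flips. -/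
theorem nonempty_equiv (h : SimpleWhitneyFlip S S' A p q) :
    Nonempty (EdgeVertexGroup S ≃ₗ[ℤ] EdgeVertexGroup S') :=
  ⟨LinearEquiv.ofLinearMap _ _ h.symm.lift_comp_lift h.lift_comp_lift⟩

end SimpleWhitneyFlip

/-! ### Tensor powers -/

section Tensor

variable {ι κ : Type u}

open Classical in
theorem fiberMul_tprod [Fintype ι] {A : Type} [CommRing A] (p : ι → κ) (a : ι → A) :
    fiberMul A p (PiTensorProduct.tprod ℤ a) =
      PiTensorProduct.tprod ℤ fun k => ∏ i with p i = k, a i := by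
  trans PiTensorProduct.tprod ℤ fun k =>
    ∏ i ∈ (@Finset.univ ι (Fintype.ofFinite ι)).filter (p · = k), a i
  · exact PiTensorProduct.lift.tprod a
  · rw [Subsingleton.elim (Fintype.ofFinite ι) ‹_›]

theorem fiberMul_fiberMul [Finite ι] [Finite κ] {μ : Type u} {A : Type} [CommRing A] (p : ι → κ)
    (q : κ → μ) (x : ⨂[ℤ] _ : ι, A) : fiberMul A q (fiberMul A p x) = fiberMul A (q ∘ p) x := by
  classical
  have := Fintype.ofFinite ι
  have := Fintype.ofFinite κ
  rw [← LinearMap.comp_apply]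
  congr 1
  ext a
  simp only [LinearMap.compMultilinearMap_apply, LinearMap.comp_apply, fiberMul_tprod]
  congr 1
  funext k
  rw [Finset.prod_sigma']
  refine Finset.prod_bij' (fun x _ => x.2) (fun i _ => ⟨p i, i⟩) ?_ ?_ ?_ ?_ ?_ <;>
    simp +contextual

theorem fiberMul_id [Finite ι] {A : Type} [CommRing A] (x : ⨂[ℤ] _ : ι, A) :
    fiberMul A (fun i : ι => i) x = x := by
  classical
  have := Fintype.ofFinite ι
  conv_rhs => rw [← LinearMap.id_apply (R := ℤ) x]
  congr 1
  ext a
  simp [fiberMul_tprod, Finset.prod_filter]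

theorem fiberMul_injective [Finite ι] {A : Type} [CommRing A] {p : ι → κ}
    (hp : Function.Bijective p) : Function.Injective (fiberMul A p) := by
  have := Finite.of_surjective p hp.2
  refine Function.LeftInverse.injective (g := fiberMul A (Equiv.ofBijective p hp).symm) fun x => ?_
  rw [fiberMul_fiberMul]
  convert fiberMul_id x with i
  exact (Equiv.ofBijective p hp).symm_apply_apply i

/-- The pure tensor of the powers of `x` with exponents `a`. -/
noncomputable def tensorMonomial (m : ℕ) (a : ι → ℕ) : ⨂[ℤ] _ : ι, TruncPoly m :=
  PiTensorProduct.tprod ℤ fun i => (AdjoinRoot.root (Polynomial.X ^ m) ^ a i : TruncPoly m)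

open Classical in
theorem fiberMul_tensorMonomial [Fintype ι] (m : ℕ) (p : ι → κ) (a : ι → ℕ) :
    fiberMul (TruncPoly m) p (tensorMonomial m a) =
      tensorMonomial m fun k => ∑ i with p i = k, a i := by
  rw [tensorMonomial, fiberMul_tprod, tensorMonomial]
  simp only [Finset.prod_pow_eq_pow_sum]

theorem root_pow_eq_zero {m n : ℕ} (h : m ≤ n) :
    (AdjoinRoot.root (Polynomial.X ^ m : Polynomial ℤ) ^ n : TruncPoly m) = 0 := by
  apply pow_eq_zero_of_le h
  have := AdjoinRoot.mk_self (f := (Polynomial.X ^ m : Polynomial ℤ))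
  rwa [map_pow, AdjoinRoot.mk_X] at this

theorem tensorMonomial_eq_zero {m : ℕ} {a : ι → ℕ} (i : ι) (h : m ≤ a i) :
    tensorMonomial m a = 0 :=
  MultilinearMap.map_coord_zero _ i (root_pow_eq_zero h)

/-- The coefficient of `x ^ n` of a truncated polynomial. -/
noncomputable def truncCoeff (m n : ℕ) : TruncPoly m →ₗ[ℤ] ℤ :=
  Polynomial.lcoeff ℤ n ∘ₗ AdjoinRoot.modByMonicHom (Polynomial.monic_X_pow m)

theorem truncCoeff_root_pow {m k : ℕ} (n : ℕ) (h : k < m) :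
    truncCoeff m n (AdjoinRoot.root (Polynomial.X ^ m) ^ k) = if n = k then 1 else 0 := by
  rw [← AdjoinRoot.mk_X, ← map_pow, truncCoeff, LinearMap.comp_apply, AdjoinRoot.modByMonicHom_mk,
    (Polynomial.modByMonic_eq_self_iff (Polynomial.monic_X_pow m)).2, Polynomial.lcoeff_apply,
    Polynomial.coeff_X_pow]
  rwa [Polynomial.degree_X_pow, Polynomial.degree_X_pow, Nat.cast_lt]

/-- The coefficient of a monomial. -/
noncomputable def tensorCoeff [Fintype ι] (m : ℕ) (b : ι → ℕ) : (⨂[ℤ] _ : ι, TruncPoly m) →ₗ[ℤ] ℤ :=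
  PiTensorProduct.lift
    ((MultilinearMap.mkPiAlgebra ℤ ι ℤ).compLinearMap fun i => truncCoeff m (b i))

open Classical in
theorem tensorCoeff_tensorMonomial [Fintype ι] {m : ℕ} (a b : ι → ℕ) (ha : ∀ i, a i < m) :
    tensorCoeff m b (tensorMonomial m a) = if b = a then 1 else 0 := by
  rw [tensorCoeff, tensorMonomial, PiTensorProduct.lift.tprod]
  simp only [MultilinearMap.compLinearMap_apply, MultilinearMap.mkPiAlgebra_apply,
    truncCoeff_root_pow _ (ha _)]
  rw [Fintype.prod_ite_zero]
  simp [funext_iff]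

theorem mem_homogeneousPart [Fintype ι] {m : ℕ} {j : ℤ} (a : ι → ℕ) (h : ((∑ i, a i : ℕ) : ℤ) = j) :
    tensorMonomial m a ∈ homogeneousPart m ι j :=
  Submodule.subset_span ⟨a, by rwa [finsum_eq_sum_of_fintype], rfl⟩

/-- Since x^m = 0, monomials with an exponent at least `m` vanish and only reduced ones need
checking. -/
theorem homogeneousPart_induction [Fintype ι] {m : ℕ} {j : ℤ}
    {P : Submodule ℤ (⨂[ℤ] _ : ι, TruncPoly m)}
    (h : ∀ a : ι → ℕ, ((∑ i, a i : ℕ) : ℤ) = j → (∀ i, a i < m) → tensorMonomial m a ∈ P) :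
    homogeneousPart m ι j ≤ P := by
  rw [homogeneousPart, Submodule.span_le]
  rintro _ ⟨a, ha, rfl⟩
  rw [finsum_eq_sum_of_fintype] at ha
  by_cases hm : ∀ i, a i < m
  · exact h a ha hm
  · push Not at hm
    obtain ⟨i, hi⟩ := hm
    have := tensorMonomial_eq_zero i hi
    rw [tensorMonomial] at this
    rw [this]
    exact zero_mem P

theorem fiberMul_mem_homogeneousPart [Finite ι] [Finite κ] {m : ℕ} {j : ℤ} (p : ι → κ)
    {x : ⨂[ℤ] _ : ι, TruncPoly m} (hx : x ∈ homogeneousPart m ι j) :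
    fiberMul (TruncPoly m) p x ∈ homogeneousPart m κ j := by
  classical
  have := Fintype.ofFinite ι
  have := Fintype.ofFinite κ
  suffices homogeneousPart m ι j ≤ (homogeneousPart m κ j).comap (fiberMul (TruncPoly m) p) from
    this hx
  apply homogeneousPart_induction
  intro a ha _
  rw [Submodule.mem_comap, fiberMul_tensorMonomial]
  apply mem_homogeneousPart
  rw [← ha, ← Finset.sum_fiberwise Finset.univ p]

theorem homogeneousPart_eq_bot [Finite ι] {j : ℤ} (h : 2 * (Nat.card ι : ℤ) < j) :
    homogeneousPart 3 ι j = ⊥ := by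
  have := Fintype.ofFinite ι
  rw [eq_bot_iff]
  apply homogeneousPart_induction
  intro a ha ha'
  have : ∑ i, a i ≤ ∑ i : ι, 2 := Finset.sum_le_sum fun i _ => Nat.lt_succ_iff.1 (ha' i)
  rw [Finset.sum_const, Finset.card_univ, ← Nat.card_eq_fintype_card, smul_eq_mul] at this
  omega

open Classical in
/-- The monomial with exponent `1` at `c` and `2` elsewhere. -/
noncomputable def coTop (c : ι) : ⨂[ℤ] _ : ι, TruncPoly 3 :=
  tensorMonomial 3 fun k => if k = c then 1 else 2

open Classical in
/-- The coefficient of the monomial with exponent `1` at `c` and `2` elsewhere. -/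
noncomputable def coTopCoeff [Fintype ι] (c : ι) : (⨂[ℤ] _ : ι, TruncPoly 3) →ₗ[ℤ] ℤ :=
  tensorCoeff 3 fun k => if k = c then 1 else 2

open Classical in
theorem coTopCoeff_coTop [Fintype ι] (c d : ι) : coTopCoeff c (coTop d) = if c = d then 1 else 0 := by
  rw [coTopCoeff, coTop, tensorCoeff_tensorMonomial _ _ fun i => by split_ifs <;> simp]
  congr 1
  rw [eq_iff_iff, funext_iff]
  constructor
  · intro h
    have := h c
    by_contra hcd
    simp [hcd] at this
  · rintro rfl _
    rfl

theorem coTop_mem [Finite ι] {j : ℤ} (hj : j = 2 * Nat.card ι - 1) (c : ι) :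
    coTop c ∈ homogeneousPart 3 ι j := by
  classical
  have := Fintype.ofFinite ι
  apply mem_homogeneousPart
  have : ∀ k : ι, ((if k = c then 1 else 2 : ℕ) : ℤ) = 2 - if k = c then 1 else 0 := by
    intro k
    split_ifs <;> simp
  rw [hj, Nat.cast_sum]
  simp only [this, Finset.sum_sub_distrib]
  simp [mul_comm]

/-- One degree below the top, the deficits `2 - a i` sum to 1, so exactly one exponent is 1 and the
rest are 2. -/
theorem eq_sum_coTop [Fintype ι] {j : ℤ} (hj : j = 2 * Nat.card ι - 1)
    {x : ⨂[ℤ] _ : ι, TruncPoly 3} (hx : x ∈ homogeneousPart 3 ι j) :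
    x = ∑ c, coTopCoeff c x • coTop c := by
  classical
  let f : (⨂[ℤ] _ : ι, TruncPoly 3) →ₗ[ℤ] (⨂[ℤ] _ : ι, TruncPoly 3) :=
    ∑ c, (coTopCoeff c).smulRight (coTop c)
  suffices homogeneousPart 3 ι j ≤ LinearMap.eqLocus LinearMap.id f by
    simpa [f] using this hx
  apply homogeneousPart_induction
  intro a ha ha'
  have hsum : ∑ i, (2 - a i) = 1 := by
    have : ∑ i, (2 - a i) + ∑ i, a i = ∑ i : ι, 2 := by
      rw [← Finset.sum_add_distrib]
      exact Finset.sum_congr rfl fun i _ => Nat.sub_add_cancel (Nat.lt_succ_iff.1 (ha' i))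
    rw [Finset.sum_const, Finset.card_univ, ← Nat.card_eq_fintype_card, smul_eq_mul] at this
    omega
  obtain ⟨c, hc⟩ : ∃ c, 2 - a c ≠ 0 := by
    by_contra hh
    push Not at hh
    simp [hh] at hsum
  rw [← Finset.add_sum_erase _ _ (Finset.mem_univ c)] at hsum
  have hzero : ∑ i ∈ Finset.univ.erase c, (2 - a i) = 0 := by omega
  rw [Finset.sum_eq_zero_iff] at hzero
  have hac : a = fun k => if k = c then 1 else 2 := by
    funext k
    have := ha' k
    split_ifs with hk
    · subst hk
      omega
    · have := hzero k (by simp [hk])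
      omega
  have : tensorMonomial 3 a = coTop c := by rw [hac, coTop]
  rw [LinearMap.mem_eqLocus, this]
  simp [f, coTopCoeff_coTop]

open Classical in
theorem fiberMul_tensorMonomial_comp [Finite ι] (m : ℕ) {p : ι → κ} (hp : Function.Bijective p)
    (a : κ → ℕ) : fiberMul (TruncPoly m) p (tensorMonomial m (a ∘ p)) = tensorMonomial m a := by
  have := Fintype.ofFinite ι
  rw [fiberMul_tensorMonomial]
  congr 1
  funext k
  obtain ⟨i, rfl⟩ := hp.2 k
  rw [Finset.sum_eq_single i]
  · rfl
  · intro b hb hbi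
    exact absurd (hp.1 (Finset.mem_filter.1 hb).2) hbi
  · simp

theorem fiberMul_coTop [Finite ι] {p : ι → κ} (hp : Function.Bijective p) (c : ι) :
    fiberMul (TruncPoly 3) p (coTop c) = coTop (p c) := by
  classical
  rw [coTop, coTop, ← fiberMul_tensorMonomial_comp 3 hp]
  congr 2
  funext i
  simp [hp.1.eq_iff]

end Tensor

/-! ### Low-degree cochains -/

namespace Multigraph

variable (G : Multigraph.{u})

noncomputable instance : Fintype G.V := Fintype.ofFinite _

noncomputable instance (s : Finset G.E) : Fintype (G.Comp s) := Fintype.ofFinite _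

variable {G}

theorem spanning_adj {s : Set G.E} {a b : G.V} :
    (G.spanning s).Adj a b ↔ a ≠ b ∧ ∃ e ∈ s, G.ends e = s(a, b) := by
  simp only [spanning, SimpleGraph.fromRel_adj, Sym2.eq_swap (a := b), or_self]

/-! ### Components of spanning subgraphs -/

/-- The component of `[G : s]` that contains a vertex. -/
def comp (s : Finset G.E) (a : G.V) : G.Comp s :=
  (G.spanning (s : Set G.E)).connectedComponentMk a

theorem comp_surjective (s : Finset G.E) : Function.Surjective (comp s) := Quot.mk_surjective

/-- The map on components induced by an inclusion of spanning subgraphs. -/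
def leMap {s t : Finset G.E} (h : G.spanning (s : Set G.E) ≤ G.spanning (t : Set G.E)) :
    G.Comp s → G.Comp t :=
  SimpleGraph.ConnectedComponent.map (SimpleGraph.Hom.ofLE h)

theorem leMap_leMap {s t u : Finset G.E}
    (h : G.spanning (s : Set G.E) ≤ G.spanning (t : Set G.E))
    (h' : G.spanning (t : Set G.E) ≤ G.spanning (u : Set G.E)) :
    leMap h' ∘ leMap h = leMap (h.trans h') := by
  funext c
  obtain ⟨a, rfl⟩ := comp_surjective s c
  rfl

theorem leMap_self {s : Finset G.E} (h : G.spanning (s : Set G.E) ≤ G.spanning (s : Set G.E)) :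
    leMap h = fun c => c := by
  funext c
  obtain ⟨a, rfl⟩ := comp_surjective s c
  rfl

theorem leMap_surjective {s t : Finset G.E}
    (h : G.spanning (s : Set G.E) ≤ G.spanning (t : Set G.E)) : Function.Surjective (leMap h) :=
  fun c => by
    obtain ⟨a, rfl⟩ := comp_surjective t c
    exact ⟨comp s a, rfl⟩

/-- Only connectivity matters, not inclusion of edge sets; this covers passage between parallel
edges and the addition or removal of a loop. -/
theorem leMap_bijective {s t : Finset G.E}
    (h : G.spanning (s : Set G.E) ≤ G.spanning (t : Set G.E))
    (h' : G.spanning (t : Set G.E) ≤ G.spanning (s : Set G.E)) : Function.Bijective (leMap h) :=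
  ⟨Function.LeftInverse.injective (g := leMap h') fun c => by
    obtain ⟨a, rfl⟩ := comp_surjective s c
    rfl, leMap_surjective h⟩

/-- The set of a single edge. -/
def single (e : G.E) : {s : Finset G.E // s.card = 1} := ⟨{e}, Finset.card_singleton e⟩

theorem exists_eq_single (s : {s : Finset G.E // s.card = 1}) : ∃ e, s = single e := by
  obtain ⟨e, he⟩ := Finset.card_eq_one.1 s.2
  exact ⟨e, Subtype.ext he⟩

theorem spanning_single_le {e : G.E} {u : Finset G.E} (he : e ∈ u) :
    G.spanning ((single e).1 : Set G.E) ≤ G.spanning (u : Set G.E) :=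
  G.spanning_mono (Finset.coe_subset.2 (Finset.singleton_subset_iff.2 he))

/-! ### The differential in degrees 0 and 1 -/

variable {A : Type} [CommRing A]

theorem fiberMul_compMap_of_eq_single (f : G.Cochain A 1) {s u : Finset G.E} (hs : s.card = 1)
    (h : s ⊆ u) {e : G.E} (he : e ∈ u) (hse : s = {e}) :
    fiberMul A (G.compMap h) (f ⟨s, hs⟩) =
      fiberMul A (leMap (spanning_single_le he)) (f (single e)) := by
  subst hse
  rfl

open Classical in
theorem d_one_apply (o : LinearOrder G.E) (f : G.Cochain A 1) {u : Finset G.E} (hu : u.card = 2)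
    {e e' : G.E} (he : e ∈ u) (he' : e' ∈ u) (hne : e ≠ e') :
    ∃ ε : ℤ, ε * ε = 1 ∧ G.d A o 1 f ⟨u, hu⟩ =
      ε • (fiberMul A (leMap (spanning_single_le he)) (f (single e)) -
        fiberMul A (leMap (spanning_single_le he')) (f (single e'))) := by
  have hu' : u = {e, e'} := by
    symm
    apply Finset.eq_of_subset_of_card_le
    · simp [Finset.insert_subset_iff, he, he']
    · rw [hu, Finset.card_pair hne]
  have h1 : u.erase e = {e'} := by
    rw [hu', Finset.erase_insert (by simpa using hne)]
  have h2 : u.erase e' = {e} := by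
    rw [hu', Finset.pair_comm, Finset.erase_insert (by simpa using hne.symm)]
  have hsub : ∀ x ∈ u, x = e ∨ x = e' := by
    intro x hx
    simpa [hu'] using hx
  rw [d, LinearMap.pi_apply, LinearMap.sum_apply,
    Fintype.sum_eq_add (⟨e, he⟩ : {x // x ∈ u}) ⟨e', he'⟩ (by simpa using hne)]
  · simp only [LinearMap.smul_apply, LinearMap.comp_apply, LinearMap.proj_apply]
    rw [fiberMul_compMap_of_eq_single f _ _ he' h1, fiberMul_compMap_of_eq_single f _ _ he h2, h1,
      h2, Finset.filter_singleton, Finset.filter_singleton]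
    rcases lt_or_gt_of_ne hne with hlt | hlt
    · refine ⟨-1, by norm_num, ?_⟩
      rw [if_neg (not_lt_of_gt hlt), if_pos hlt]
      simp
      abel
    · refine ⟨1, by norm_num, ?_⟩
      rw [if_pos hlt, if_neg (not_lt_of_gt hlt)]
      simp
      abel
  · rintro ⟨x, hx⟩ ⟨h3, h4⟩
    rcases hsub x hx with rfl | rfl
    · exact absurd rfl h3
    · exact absurd rfl h4

/-- The two terms at a pair of edges have opposite signs, so the cocycle condition is an equality in
which the edge order no longer appears. -/
theorem mem_ker_d_one_iff (o : LinearOrder G.E) (f : G.Cochain A 1) :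
    f ∈ LinearMap.ker (G.d A o 1) ↔ ∀ (u : Finset G.E), u.card = 2 → ∀ e e' (he : e ∈ u)
      (he' : e' ∈ u), e ≠ e' → fiberMul A (leMap (spanning_single_le he)) (f (single e)) =
        fiberMul A (leMap (spanning_single_le he')) (f (single e')) := by
  rw [LinearMap.mem_ker]
  constructor
  · intro hf u hu e e' he he' hne
    obtain ⟨ε, hε, h⟩ := d_one_apply o f hu he he' hne
    rw [hf, Pi.zero_apply] at h
    have := congrArg (ε • ·) h
    simp only [smul_smul, hε, smul_zero, one_smul] at this
    exact (sub_eq_zero.1 this.symm)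
  · intro h
    funext ⟨u, hu⟩
    obtain ⟨e, e', hne, hu'⟩ := Finset.card_eq_two.1 hu
    have he : e ∈ u := by simp [hu']
    have he' : e' ∈ u := by simp [hu']
    obtain ⟨ε, -, h'⟩ := d_one_apply o f hu he he' hne
    rw [h', h u hu e e' he he' hne, sub_self, smul_zero, Pi.zero_apply]

theorem spanning_empty_le (s : Finset G.E) :
    G.spanning ((∅ : Finset G.E) : Set G.E) ≤ G.spanning (s : Set G.E) :=
  G.spanning_mono (by simp)

theorem d_zero_apply (o : LinearOrder G.E) (g : G.Cochain A 0) (e : G.E) :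
    G.d A o 0 g (single e) =
      fiberMul A (leMap (spanning_empty_le _)) (g ⟨∅, Finset.card_empty⟩) := by
  have key : ∀ (s u : Finset G.E) (hs : s.card = 0) (h : s ⊆ u), s = ∅ →
      fiberMul A (G.compMap h) (g ⟨s, hs⟩) =
        fiberMul A (leMap (spanning_empty_le u)) (g ⟨∅, Finset.card_empty⟩) := by
    rintro s u hs h rfl
    rfl
  have hmem : e ∈ (single e).1 := Finset.mem_singleton_self e
  rw [d, LinearMap.pi_apply, LinearMap.sum_apply,
    Fintype.sum_eq_single (⟨e, hmem⟩ : {x // x ∈ (single e).1})]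
  · simp only [LinearMap.smul_apply, LinearMap.comp_apply, LinearMap.proj_apply]
    rw [key _ _ _ _ (by simp [single])]
    simp only [single, Finset.erase_singleton, Finset.filter_empty, Finset.card_empty, pow_zero]
    exact DFunLike.congr_fun (one_smul ℤ (fiberMul A _)) _
  · rintro ⟨x, hx⟩ h
    exact absurd (Subtype.ext (Finset.mem_singleton.1 hx)) h

/-! ### Graphs with a loop -/

theorem subsingleton_cohomology (o : LinearOrder G.E) {m i : ℕ} {j : ℤ}
    (h : G.cocycles o m i j ≤ G.coboundaries o m i j) : Subsingleton (G.Cohomology o m i j) := by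
  rw [Submodule.Quotient.subsingleton_iff, Submodule.submoduleOf, Submodule.comap_subtype_eq_top]
  exact h

/-- The first chromatic cohomology of a graph with a loop vanishes. -/
theorem subsingleton_of_isDiag (o : LinearOrder G.E) (m : ℕ) (j : ℤ) {l : G.E}
    (hl : (G.ends l).IsDiag) : Subsingleton (G.Cohomology o m 1 j) := by
  classical
  apply subsingleton_cohomology
  rintro f ⟨hf, hf'⟩
  have hle : ∀ s t : Finset G.E, (∀ e ∈ s, e = l ∨ e ∈ t) →
      G.spanning (s : Set G.E) ≤ G.spanning (t : Set G.E) := by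
    intro s t hst a b
    rw [spanning_adj, spanning_adj]
    rintro ⟨hab, e, he, hab'⟩
    refine ⟨hab, e, (hst e he).resolve_left ?_, hab'⟩
    rintro rfl
    rw [hab'] at hl
    exact hab hl
  have hl1 : ∀ t : Finset G.E, ∀ e ∈ (single l).1, e = l ∨ e ∈ t := fun t e he =>
    .inl (Finset.mem_singleton.1 he)
  -- A loop does not change the components, so the value of `f` at `l` can be read as a 0-cochain;
  -- it is a primitive of `f`.
  refine ⟨fun s => fiberMul (TruncPoly m) (leMap (hle (single l).1 s.1 (hl1 _))) (f (single l)), ?_, ?_⟩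
  · intro s _
    exact fiberMul_mem_homogeneousPart _ (hf' (single l) trivial)
  · funext s
    obtain ⟨e, rfl⟩ := exists_eq_single s
    rw [d_zero_apply, fiberMul_fiberMul, leMap_leMap]
    by_cases hel : e = l
    · subst hel
      rw [leMap_self, fiberMul_id]
    · have h1 : e ∈ ({e, l} : Finset G.E) := by simp
      have h2 : l ∈ ({e, l} : Finset G.E) := by simp
      -- Passing from {e} to {e, l} is an isomorphism, and there the cocycle condition compares `f`
      -- at `e` and at `l`.
      apply fiberMul_injective (leMap_bijective (spanning_single_le h1)
        (hle _ _ fun x hx => by simpa [single, or_comm] using hx))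
      rw [fiberMul_fiberMul, leMap_leMap]
      exact ((mem_ker_d_one_iff o f).1 hf _ (Finset.card_pair hel) e l h1 h2 hel).symm

end Multigraph

/-! ### Chromatic cohomology of loopless graphs -/

namespace Multigraph

variable {G : Multigraph.{u}}

/-- This identifies the components for a single edge with the vertices of the contracted graph G/e.
-/
theorem comp_single_eq_iff {e : G.E} {a b : G.V} :
    comp (single e).1 a = comp (single e).1 b ↔ a = b ∨ G.ends e = s(a, b) := by
  rw [comp, comp, SimpleGraph.ConnectedComponent.eq]
  constructor
  · intro h
    rw [SimpleGraph.reachable_iff_reflTransGen] at h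
    induction h with
    | refl => exact .inl rfl
    | tail _ hstep ih =>
      obtain ⟨hne, e', he', hbc⟩ := spanning_adj.1 hstep
      obtain rfl : e' = e := by simpa [single] using he'
      rcases ih with rfl | ih
      · exact .inr hbc
      · rw [hbc, Sym2.eq_iff] at ih
        rcases ih with ⟨-, h⟩ | ⟨-, h⟩
        · exact absurd h.symm hne
        · exact .inl h.symm
  · rintro (rfl | h)
    · rfl
    · by_cases hab : a = b
      · rw [hab]
      · exact (spanning_adj.2 ⟨hab, e, by simp [single], h⟩).reachable

theorem card_comp_single {e : G.E} {a b : G.V} (he : G.ends e = s(a, b)) (hab : a ≠ b) :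
    (Nat.card (G.Comp (single e).1) : ℤ) = Nat.card G.V - 1 := by
  classical
  have hbij : Function.Bijective fun x : {x : G.V // x ≠ b} => comp (single e).1 x.1 := by
    constructor
    · rintro ⟨x, hx⟩ ⟨y, hy⟩ hxy
      rcases comp_single_eq_iff.1 hxy with h | h
      · exact Subtype.ext h
      · rw [he, Sym2.eq_iff] at h
        rcases h with ⟨-, h⟩ | ⟨-, h⟩
        · exact absurd h.symm hy
        · exact absurd h.symm hx
    · intro c
      obtain ⟨x, rfl⟩ := comp_surjective _ c
      by_cases hx : x = b
      · exact ⟨⟨a, hab⟩, comp_single_eq_iff.2 (.inr (by rw [he, hx]))⟩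
      · exact ⟨⟨x, hx⟩, rfl⟩
  have h1 := Nat.card_eq_of_bijective _ hbij
  have h2 : Fintype.card {x : G.V // x ≠ b} = Fintype.card G.V - 1 := by
    rw [Fintype.card_subtype_compl, Fintype.card_subtype_eq]
  have h3 : 0 < Fintype.card G.V := Fintype.card_pos_iff.2 ⟨b⟩
  rw [← h1, Nat.card_eq_fintype_card, Nat.card_eq_fintype_card, h2]
  omega

/-- The degree `2v - 3`. -/
noncomputable abbrev coDegree (G : Multigraph.{u}) : ℤ := 2 * (Nat.card G.V : ℤ) - 3

theorem Loopless.exists_ends (hG : G.Loopless) (e : G.E) :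
    ∃ a b, a ≠ b ∧ G.ends e = s(a, b) := by
  have := hG e
  induction h : G.ends e with | _ a b =>
  rw [h] at this
  exact ⟨a, b, this, rfl⟩

/-- 2v − 3 = 2(v − 1) − 1 is one below the top degree at a single edge. -/
theorem Loopless.coDegree_eq (hG : G.Loopless) (e : G.E) :
    G.coDegree = 2 * Nat.card (G.Comp (single e).1) - 1 := by
  obtain ⟨a, b, hab, he⟩ := hG.exists_ends e
  rw [card_comp_single he hab, coDegree]
  ring

/-- A second, non-parallel edge merges two more components, which lowers the top degree below 2v −
3. -/
theorem Loopless.homogeneousPart_pair (hG : G.Loopless) {u : Finset G.E} {e e' : G.E} (he : e ∈ u)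
    (he' : e' ∈ u) (hne : G.ends e ≠ G.ends e') :
    homogeneousPart 3 (G.Comp u) G.coDegree = ⊥ := by
  apply homogeneousPart_eq_bot
  rw [hG.coDegree_eq e]
  obtain ⟨a, b, hab, hab'⟩ := hG.exists_ends e'
  have : Nat.card (G.Comp u) < Nat.card (G.Comp (single e).1) := by
    have hsurj := leMap_surjective (spanning_single_le he)
    refine lt_of_le_of_ne (Nat.card_le_card_of_surjective _ hsurj) fun hcard => ?_
    have hinj := ((Function.Surjective.bijective_of_nat_card_le hsurj hcard.ge).1)
    have h1 : comp u a = comp u b := by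
      have := comp_single_eq_iff.2 (.inr hab')
      exact congrArg (leMap (spanning_single_le he')) this
    have h2 : comp (single e).1 a = comp (single e).1 b := hinj h1
    rcases comp_single_eq_iff.1 h2 with h | h
    · exact hab h
    · exact hne (h.trans hab'.symm)
  omega

theorem spanning_le_of_parallel {e e' : G.E} {u : Finset G.E} (h : G.ends e = G.ends e')
    (he' : e' ∈ u) : G.spanning ((single e).1 : Set G.E) ≤ G.spanning (u : Set G.E) := by
  intro a b
  rw [spanning_adj, spanning_adj]
  rintro ⟨hab, e'', he'', hab'⟩
  obtain rfl : e'' = e := by simpa [single] using he''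
  exact ⟨hab, e', he', h ▸ hab'⟩

theorem single_le_of_parallel {e e' : G.E} (h : G.ends e = G.ends e') :
    G.spanning ((single e).1 : Set G.E) ≤ G.spanning ((single e').1 : Set G.E) :=
  spanning_le_of_parallel h (Finset.mem_singleton_self e')

/-- A cochain of degree `2v - 3` on the single edges of a loopless graph is a cocycle if and only
if it agrees on parallel edges. -/
theorem Loopless.mem_cocycles_iff (hG : G.Loopless) (o : LinearOrder G.E)
    {f : G.Cochain (TruncPoly 3) 1} (hf : f ∈ G.gradedCochain 3 1 G.coDegree) :
    f ∈ G.cocycles o 3 1 G.coDegree ↔ ∀ e e' (h : G.ends e = G.ends e'),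
      fiberMul (TruncPoly 3) (leMap (single_le_of_parallel h)) (f (single e)) = f (single e') := by
  classical
  rw [cocycles, Submodule.mem_inf, and_iff_left hf, mem_ker_d_one_iff]
  constructor
  · intro hd e e' h
    by_cases hee : e = e'
    · subst hee
      rw [leMap_self, fiberMul_id]
    have h1 : e ∈ ({e, e'} : Finset G.E) := by simp
    have h2 : e' ∈ ({e, e'} : Finset G.E) := by simp
    have hle : G.spanning ((({e, e'} : Finset G.E)) : Set G.E) ≤
        G.spanning ((single e').1 : Set G.E) := by
      intro a b
      rw [spanning_adj, spanning_adj]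
      rintro ⟨hab, e'', he'', hab'⟩
      refine ⟨hab, e', by simp [single], ?_⟩
      simp only [Finset.coe_insert, Finset.coe_singleton, Set.mem_insert_iff,
        Set.mem_singleton_iff] at he''
      rcases he'' with rfl | rfl
      · exact h ▸ hab'
      · exact hab'
    apply fiberMul_injective (leMap_bijective (spanning_single_le h2) hle)
    rw [fiberMul_fiberMul, leMap_leMap]
    exact hd _ (Finset.card_pair hee) e e' h1 h2 hee
  · intro hpar u hu e e' he he' hne
    by_cases h : G.ends e = G.ends e'
    · rw [← hpar e e' h, fiberMul_fiberMul, leMap_leMap]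
    · have hmem : ∀ x (hx : x ∈ u), fiberMul (TruncPoly 3) (leMap (spanning_single_le hx))
          (f (single x)) = 0 := by
        intro x hx
        have := fiberMul_mem_homogeneousPart (leMap (spanning_single_le hx))
          (hf (single x) trivial)
        rwa [hG.homogeneousPart_pair he he' h, Submodule.mem_bot] at this
      rw [hmem e he, hmem e' he']

/-! #### The cocycles given by an edge and a vertex -/

open Classical in
/-- The cochain whose value at the edges that join `a` and `b` is the monomial with
exponent `1` at the component of `c` and `2` elsewhere. -/
noncomputable def edgeCochain (G : Multigraph.{u}) (a b c : G.V) : G.Cochain (TruncPoly 3) 1 :=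
  fun s => if ∃ e, s = single e ∧ G.ends e = s(a, b) then coTop (comp s.1 c) else 0

theorem single_injective : Function.Injective (single (G := G)) := fun _ _ h =>
  Finset.singleton_injective (congrArg Subtype.val h)

open Classical in
theorem edgeCochain_single (a b c : G.V) (e : G.E) :
    G.edgeCochain a b c (single e) =
      if G.ends e = s(a, b) then coTop (comp (single e).1 c) else 0 := by
  rw [edgeCochain]
  congr 1
  rw [eq_iff_iff]
  constructor
  · rintro ⟨e', he', h⟩
    rwa [single_injective he']
  · exact fun h => ⟨e, rfl, h⟩

theorem Loopless.edgeCochain_mem_graded (hG : G.Loopless) (a b c : G.V) :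
    G.edgeCochain a b c ∈ G.gradedCochain 3 1 G.coDegree := by
  intro s _
  obtain ⟨e, rfl⟩ := exists_eq_single s
  rw [edgeCochain_single]
  split_ifs
  · exact coTop_mem (hG.coDegree_eq e) _
  · exact zero_mem _

theorem Loopless.edgeCochain_mem (hG : G.Loopless) (o : LinearOrder G.E) (a b c : G.V) :
    G.edgeCochain a b c ∈ G.cocycles o 3 1 G.coDegree := by
  rw [hG.mem_cocycles_iff o (hG.edgeCochain_mem_graded a b c)]
  intro e e' h
  rw [edgeCochain_single, edgeCochain_single, h]
  split_ifs
  · exact fiberMul_coTop (leMap_bijective _ (single_le_of_parallel h.symm)) _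
  · rw [map_zero]

/-! #### Coboundaries -/

/-- The `0`-cochain given by a monomial in the vertices. -/
noncomputable def vertexCochain (G : Multigraph.{u}) (a : G.V → ℕ) : G.Cochain (TruncPoly 3) 0 :=
  fun s => fiberMul (TruncPoly 3) (comp s.1) (tensorMonomial 3 a)

theorem d_vertexCochain (o : LinearOrder G.E) (a : G.V → ℕ) (e : G.E) :
    G.d (TruncPoly 3) o 0 (G.vertexCochain a) (single e) =
      fiberMul (TruncPoly 3) (comp (single e).1) (tensorMonomial 3 a) := by
  rw [d_zero_apply, vertexCochain, fiberMul_fiberMul]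
  rfl

theorem comp_empty_bijective : Function.Bijective (comp (∅ : Finset G.E)) := by
  refine ⟨fun a b h => ?_, comp_surjective _⟩
  have h := SimpleGraph.ConnectedComponent.eq.1 h
  rw [SimpleGraph.reachable_iff_reflTransGen] at h
  induction h with
  | refl => rfl
  | tail _ hbc _ =>
    obtain ⟨-, e, he, -⟩ := spanning_adj.1 hbc
    simp at he

theorem vertexCochain_mem {a : G.V → ℕ} {j : ℤ} (h : ((∑ x, a x : ℕ) : ℤ) = j) :
    G.vertexCochain a ∈ G.gradedCochain 3 0 j :=
  fun _ _ => fiberMul_mem_homogeneousPart _ (mem_homogeneousPart _ h)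

/-- The complex has a single summand in cohomological degree 0, and its tensor factors correspond to
the vertices. -/
theorem gradedCochain_zero_le {j : ℤ} {P : Submodule ℤ (G.Cochain (TruncPoly 3) 0)}
    (h : ∀ a : G.V → ℕ, ((∑ x, a x : ℕ) : ℤ) = j → (∀ x, a x < 3) → G.vertexCochain a ∈ P) :
    G.gradedCochain 3 0 j ≤ P := by
  intro g hg
  let L : (⨂[ℤ] _ : G.Comp ∅, TruncPoly 3) →ₗ[ℤ] G.Cochain (TruncPoly 3) 0 :=
    LinearMap.pi fun s => fiberMul (TruncPoly 3) (leMap (spanning_empty_le s.1))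
  have hL : L (g ⟨∅, Finset.card_empty⟩) = g := by
    funext ⟨s, hs⟩
    obtain rfl := Finset.card_eq_zero.1 hs
    change fiberMul (TruncPoly 3) (leMap _) _ = _
    rw [leMap_self, fiberMul_id]
  suffices homogeneousPart 3 (G.Comp ∅) j ≤ P.comap L by
    have := this (hg ⟨∅, Finset.card_empty⟩ trivial)
    rwa [Submodule.mem_comap, hL] at this
  apply homogeneousPart_induction
  intro a ha ha'
  have : L (tensorMonomial 3 a) = G.vertexCochain (a ∘ comp ∅) := by
    rw [← fiberMul_tensorMonomial_comp 3 comp_empty_bijective]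
    funext s
    rw [LinearMap.pi_apply, fiberMul_fiberMul]
    rfl
  rw [Submodule.mem_comap, this]
  refine h _ ?_ fun x => ha' _
  rw [← ha]
  congr 1
  exact Fintype.sum_bijective _ comp_empty_bijective _ _ fun _ => rfl

open Classical in
theorem sum_fiber_of_mem {e : G.E} {p q : G.V} (he : G.ends e = s(p, q)) (hpq : p ≠ q)
    (a : G.V → ℕ) :
    ∑ i with comp (single e).1 i = comp (single e).1 p, a i = a p + a q := by
  rw [← Finset.sum_pair hpq]
  congr 1
  ext i
  simp only [Finset.mem_filter, Finset.mem_univ, true_and, comp_single_eq_iff, he, Sym2.eq_iff,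
    Finset.mem_insert, Finset.mem_singleton]
  grind

open Classical in
theorem sum_fiber_of_ne {e : G.E} {p q x : G.V} (he : G.ends e = s(p, q)) (hp : x ≠ p)
    (hq : x ≠ q) (a : G.V → ℕ) :
    ∑ i with comp (single e).1 i = comp (single e).1 x, a i = a x := by
  rw [Finset.sum_eq_single x]
  · intro i hi hix
    have := comp_single_eq_iff.1 (Finset.mem_filter.1 hi).2
    rw [he, Sym2.eq_iff] at this
    grind
  · simp

theorem fiberMul_eq_zero {e : G.E} {p q : G.V} (he : G.ends e = s(p, q)) (hpq : p ≠ q)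
    {a : G.V → ℕ} (ha : 3 ≤ a p + a q) :
    fiberMul (TruncPoly 3) (comp (single e).1) (tensorMonomial 3 a) = 0 := by
  classical
  rw [fiberMul_tensorMonomial]
  apply tensorMonomial_eq_zero (comp (single e).1 p)
  rwa [sum_fiber_of_mem he hpq]

open Classical in
theorem fiberMul_eq_coTop {e : G.E} {p q c : G.V} (he : G.ends e = s(p, q)) (hpq : p ≠ q)
    {a : G.V → ℕ} (ha : a p + a q = if c = p ∨ c = q then 1 else 2)
    (ha' : ∀ x, x ≠ p → x ≠ q → a x = if x = c then 1 else 2) :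
    fiberMul (TruncPoly 3) (comp (single e).1) (tensorMonomial 3 a) =
      coTop (comp (single e).1 c) := by
  rw [fiberMul_tensorMonomial, coTop]
  congr 1
  funext k
  obtain ⟨x, rfl⟩ := comp_surjective _ k
  have hq : comp (single e).1 q = comp (single e).1 p :=
    comp_single_eq_iff.2 (.inr (by rw [he, Sym2.eq_swap]))
  have hp : ∑ i with comp (single e).1 i = comp (single e).1 p, a i =
      if comp (single e).1 p = comp (single e).1 c then 1 else 2 := by
    rw [sum_fiber_of_mem he hpq, ha]
    congr 1
    rw [comp_single_eq_iff, he, Sym2.eq_iff, eq_iff_iff]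
    grind
  by_cases hxp : x = p
  · rw [hxp, hp]
  by_cases hxq : x = q
  · rw [hxq, hq, hp]
  rw [sum_fiber_of_ne he hxp hxq, ha' x hxp hxq]
  congr 1
  rw [comp_single_eq_iff, he, Sym2.eq_iff, eq_iff_iff]
  grind

-- An edge `ac` absorbs the exponent 0 and leaves the monomial of (ac, b). An edge that avoids `a`
-- has exponents of sum at least 3 at its ends, and x^3 = 0.
open Classical in
theorem Loopless.d_vertexCochain_star (hG : G.Loopless) (o : LinearOrder G.E) {a b : G.V}
    (hab : a ≠ b) :
    G.d (TruncPoly 3) o 0 (G.vertexCochain fun x => if x = a then 0 else if x = b then 1 else 2) =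
      ∑ c, G.edgeCochain a c b := by
  funext s
  obtain ⟨e, rfl⟩ := exists_eq_single s
  obtain ⟨p, q, hpq, he⟩ := hG.exists_ends e
  rw [d_vertexCochain, Finset.sum_apply]
  simp only [edgeCochain_single]
  by_cases hae : a ∈ G.ends e
  · obtain ⟨r, hr⟩ := Sym2.mem_iff_exists.1 hae
    have har : a ≠ r := by
      rintro rfl
      exact hG e (by rw [hr]; exact Sym2.mk_isDiag_iff.2 rfl)
    rw [Finset.sum_eq_single r, if_pos hr]
    · apply fiberMul_eq_coTop hr har <;> grind
    · intro c _ hc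
      rw [if_neg]
      rw [hr, Sym2.eq_iff]
      grind
    · simp
  · rw [Finset.sum_eq_zero, fiberMul_eq_zero he hpq]
    · rw [he, Sym2.mem_iff] at hae
      grind
    · intro c _
      rw [if_neg]
      intro h
      exact hae (by simp [h])

-- An edge between two of the three vertices gets exponent 1 + 1 = 2 and leaves the third with
-- exponent 1; any other edge gets at least 3.
open Classical in
theorem Loopless.d_vertexCochain_triple (hG : G.Loopless) (o : LinearOrder G.E) {a b c : G.V}
    (hab : a ≠ b) (hbc : b ≠ c) (hca : c ≠ a) :
    G.d (TruncPoly 3) o 0 (G.vertexCochain fun x => if x = a ∨ x = b ∨ x = c then 1 else 2) =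
      G.edgeCochain a b c + G.edgeCochain b c a + G.edgeCochain c a b := by
  funext s
  obtain ⟨e, rfl⟩ := exists_eq_single s
  obtain ⟨p, q, hpq, he⟩ := hG.exists_ends e
  rw [d_vertexCochain, Pi.add_apply, Pi.add_apply]
  simp only [edgeCochain_single]
  by_cases h1 : G.ends e = s(a, b)
  · rw [if_pos h1, if_neg, if_neg, add_zero, add_zero]
    · apply fiberMul_eq_coTop h1 hab <;> grind
    all_goals rw [h1, Sym2.eq_iff]; grind
  by_cases h2 : G.ends e = s(b, c)
  · rw [if_neg h1, if_pos h2, if_neg, add_zero, zero_add (coTop _)]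
    · apply fiberMul_eq_coTop h2 hbc <;> grind
    all_goals rw [h2, Sym2.eq_iff]; grind
  by_cases h3 : G.ends e = s(c, a)
  · rw [if_neg h1, if_neg h2, if_pos h3]
    trans coTop (comp (single e).1 b)
    · apply fiberMul_eq_coTop h3 hca <;> grind
    · abel
  · rw [if_neg h1, if_neg h2, if_neg h3, add_zero, add_zero, fiberMul_eq_zero he hpq]
    rw [he, Sym2.eq_iff] at h1 h2 h3
    grind

/-- The exponents of the monomials of degree `2v - 3`. -/
theorem exponents_cases {V : Type*} [Fintype V] [DecidableEq V] {a : V → ℕ} (ha : ∀ x, a x < 3)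
    (hsum : ((∑ x, a x : ℕ) : ℤ) = 2 * (Nat.card V : ℤ) - 3) :
    (∃ p q, p ≠ q ∧ a = fun x => if x = p then 0 else if x = q then 1 else 2) ∨
      ∃ p q r, p ≠ q ∧ q ≠ r ∧ r ≠ p ∧ a = fun x => if x = p ∨ x = q ∨ x = r then 1 else 2 := by
  -- The deficits are at most 2 and sum to 3, so they are either 2 + 1 or 1 + 1 + 1.
  have hsum' : ∑ i, (2 - a i) = 3 := by
    have : ∑ i, (2 - a i) + ∑ i, a i = ∑ i : V, 2 := by
      rw [← Finset.sum_add_distrib]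
      exact Finset.sum_congr rfl fun i _ => Nat.sub_add_cancel (Nat.lt_succ_iff.1 (ha i))
    rw [Finset.sum_const, Finset.card_univ, ← Nat.card_eq_fintype_card, smul_eq_mul] at this
    omega
  by_cases hzero : ∃ p, a p = 0
  · left
    obtain ⟨p, hp⟩ := hzero
    rw [← Finset.add_sum_erase _ _ (Finset.mem_univ p)] at hsum'
    have h1 : ∑ i ∈ Finset.univ.erase p, (2 - a i) = 1 := by omega
    obtain ⟨q, hq, hq'⟩ : ∃ q ∈ Finset.univ.erase p, 2 - a q ≠ 0 := by
      by_contra hh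
      push Not at hh
      rw [Finset.sum_eq_zero hh] at h1
      omega
    rw [← Finset.add_sum_erase _ _ hq] at h1
    have h2 : ∑ i ∈ (Finset.univ.erase p).erase q, (2 - a i) = 0 := by omega
    rw [Finset.sum_eq_zero_iff] at h2
    have hqp : q ≠ p := by simpa using hq
    refine ⟨p, q, hqp.symm, ?_⟩
    funext x
    have := ha x
    have := h2 x
    simp only [Finset.mem_erase, Finset.mem_univ, and_true] at this
    split_ifs with hx hx'
    · rw [hx, hp]
    · subst hx'
      omega
    · have := this ⟨hx', hx⟩
      omega
  · right
    push Not at hzero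
    have hcard : (Finset.univ.filter fun x => a x = 1).card = 3 := by
      rw [Finset.card_filter, ← hsum']
      refine Finset.sum_congr rfl fun x _ => ?_
      have := ha x
      have := hzero x
      split_ifs <;> omega
    obtain ⟨p, q, r, hpq, hpr, hqr, h⟩ := Finset.card_eq_three.1 hcard
    refine ⟨p, q, r, hpq, hqr, hpr.symm, ?_⟩
    funext x
    have hx : a x = 1 ↔ x = p ∨ x = q ∨ x = r := by
      simpa using Finset.ext_iff.1 h x
    have := ha x
    have := hzero x
    split_ifs with hx' <;> grind

/-! #### The comparison -/

open EdgeVertexGroup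

/-- The group of edge-vertex pairs of the underlying simple graph. -/
abbrev pairGroup (G : Multigraph.{u}) : Type u := EdgeVertexGroup (G.spanning Set.univ)

/-- The generator given by an unordered pair of vertices and a vertex. -/
noncomputable def pairGen (G : Multigraph.{u}) (p : Sym2 G.V) (c : G.V) : G.pairGroup :=
  Sym2.lift ⟨fun a b => of _ a b c, fun a b => (isEdgeVertexFun_of _).swap a b c⟩ p

/-- This makes the choice of a vertex in each component harmless in `toPairs`. -/
theorem pairGen_eq_of_comp {e : G.E} {c d : G.V}
    (h : comp (single e).1 c = comp (single e).1 d) :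
    G.pairGen (G.ends e) c = G.pairGen (G.ends e) d := by
  rcases comp_single_eq_iff.1 h with rfl | h
  · rfl
  · rw [h]
    exact (isEdgeVertexFun_of _).ends c d

/-- A choice of an edge with given end points. -/
noncomputable def rep (p : Set.range G.ends) : G.E := p.2.choose

theorem ends_rep (p : Set.range G.ends) : G.ends (rep p) = p := p.2.choose_spec

noncomputable instance : Fintype (Set.range G.ends) := Fintype.ofFinite _

/-- The map from cochains to the group of edge-vertex pairs. -/
noncomputable def toPairs (G : Multigraph.{u}) : G.Cochain (TruncPoly 3) 1 →ₗ[ℤ] G.pairGroup :=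
  ∑ p : Set.range G.ends, ∑ c : G.Comp (single (rep p)).1,
    ((coTopCoeff c).smulRight (G.pairGen p c.out)) ∘ₗ LinearMap.proj (single (rep p))

theorem toPairs_apply (f : G.Cochain (TruncPoly 3) 1) :
    G.toPairs f = ∑ p : Set.range G.ends, ∑ c : G.Comp (single (rep p)).1,
      coTopCoeff c (f (single (rep p))) • G.pairGen p c.out := by
  simp [toPairs]

theorem comp_out {s : Finset G.E} (c : G.Comp s) : comp s c.out = c := Quot.out_eq c

theorem Loopless.edgeCochain_eq_zero (hG : G.Loopless) {a b : G.V}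
    (h : ¬ (G.spanning Set.univ).Adj a b) (c : G.V) : G.edgeCochain a b c = 0 := by
  classical
  funext s
  obtain ⟨e, rfl⟩ := exists_eq_single s
  rw [edgeCochain_single, if_neg, Pi.zero_apply]
  intro he
  refine h (spanning_adj.2 ⟨?_, e, trivial, he⟩)
  rintro rfl
  exact hG e (by rw [he]; exact Sym2.mk_isDiag_iff.2 rfl)

theorem Loopless.toPairs_edgeCochain (hG : G.Loopless) (a b c : G.V) :
    G.toPairs (G.edgeCochain a b c) = of _ a b c := by
  classical
  by_cases hab : (G.spanning Set.univ).Adj a b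
  · obtain ⟨-, e, -, he⟩ := spanning_adj.1 hab
    let p : Set.range G.ends := ⟨s(a, b), e, he⟩
    have hp : G.ends (rep p) = s(a, b) := ends_rep p
    rw [toPairs_apply, Fintype.sum_eq_single p, Fintype.sum_eq_single (comp _ c)]
    · rw [edgeCochain_single, if_pos hp, coTopCoeff_coTop, if_pos rfl, one_smul, ← ends_rep p,
        pairGen_eq_of_comp (comp_out _), hp]
      rfl
    · intro d hd
      rw [edgeCochain_single, if_pos hp, coTopCoeff_coTop, if_neg hd, zero_smul]
    · intro p' hp'
      refine Finset.sum_eq_zero fun d _ => ?_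
      rw [edgeCochain_single, if_neg, map_zero, zero_smul]
      rw [ends_rep]
      exact fun h => hp' (Subtype.ext h)
  · rw [hG.edgeCochain_eq_zero hab, map_zero, (isEdgeVertexFun_of _).nonadj _ _ _ hab]

/-- By `exponents_cases` the coboundaries are spanned by those of two kinds of monomials, which are
exactly the star and triple relations. -/
theorem Loopless.toPairs_coboundary (hG : G.Loopless) (o : LinearOrder G.E) :
    G.coboundaries o 3 1 G.coDegree ≤ LinearMap.ker G.toPairs := by
  classical
  rw [coboundaries, Submodule.map_le_iff_le_comap]
  apply gradedCochain_zero_le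
  intro a hsum ha
  rw [Submodule.mem_comap, LinearMap.mem_ker]
  rcases exponents_cases ha hsum with ⟨p, q, hpq, rfl⟩ | ⟨p, q, r, hpq, hqr, hrp, rfl⟩
  · rw [hG.d_vertexCochain_star o hpq, map_sum]
    simp only [hG.toPairs_edgeCochain]
    exact (isEdgeVertexFun_of _).star p q hpq
  · rw [hG.d_vertexCochain_triple o hpq hqr hrp, map_add, map_add]
    simp only [hG.toPairs_edgeCochain]
    exact (isEdgeVertexFun_of _).triple p q r hpq hqr hrp

/-- The class of `edgeCochain`. -/
noncomputable def Loopless.edgeClass (hG : G.Loopless) (o : LinearOrder G.E) (a b c : G.V) :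
    G.firstCohomology o := Submodule.Quotient.mk ⟨G.edgeCochain a b c, hG.edgeCochain_mem o a b c⟩

theorem sum_exponents_star {V : Type*} [Fintype V] [DecidableEq V] {p q : V} (hpq : p ≠ q) :
    ((∑ x : V, (if x = p then 0 else if x = q then 1 else 2) : ℕ) : ℤ) =
      2 * (Nat.card V : ℤ) - 3 := by
  have : ∀ x : V, ((if x = p then 0 else if x = q then 1 else 2 : ℕ) : ℤ) =
      2 - (if x = p then 2 else 0) - (if x = q then 1 else 0) := by
    intro x
    split_ifs with h1 h2 <;> simp
    exact hpq (h1.symm.trans h2)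
  rw [Nat.cast_sum]
  simp only [this, Finset.sum_sub_distrib]
  simp
  ring

theorem sum_exponents_triple {V : Type*} [Fintype V] [DecidableEq V] {p q r : V} (hpq : p ≠ q)
    (hqr : q ≠ r) (hrp : r ≠ p) :
    ((∑ x : V, (if x = p ∨ x = q ∨ x = r then 1 else 2) : ℕ) : ℤ) =
      2 * (Nat.card V : ℤ) - 3 := by
  have : ∀ x : V, ((if x = p ∨ x = q ∨ x = r then 1 else 2 : ℕ) : ℤ) =
      2 - (if x = p then 1 else 0) - (if x = q then 1 else 0) - (if x = r then 1 else 0) := by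
    intro x
    split_ifs <;> grind
  rw [Nat.cast_sum]
  simp only [this, Finset.sum_sub_distrib]
  simp
  ring

/-- `swap`, `nonadj` and `ends` hold already for cochains; `triple` and `star` hold modulo the
coboundaries of the two kinds of monomials. -/
theorem Loopless.isEdgeVertexFun_edgeClass (hG : G.Loopless) (o : LinearOrder G.E) :
    IsEdgeVertexFun (G.spanning Set.univ) (hG.edgeClass o) := by
  classical
  have hmk : ∀ x : G.cocycles o 3 1 G.coDegree, x.1 ∈ G.coboundaries o 3 1 G.coDegree →
      (Submodule.Quotient.mk x : G.firstCohomology o) = 0 := fun x hx =>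
    (Submodule.Quotient.mk_eq_zero _).2 hx
  constructor
  · intro a b c
    have : G.edgeCochain a b c = G.edgeCochain b a c := by
      funext s
      obtain ⟨e, rfl⟩ := exists_eq_single s
      rw [edgeCochain_single, edgeCochain_single, Sym2.eq_swap]
    simp only [edgeClass, this]
  · intro a b c hab
    refine hmk _ ?_
    change G.edgeCochain a b c ∈ _
    rw [hG.edgeCochain_eq_zero hab]
    exact zero_mem _
  · intro a b
    have : G.edgeCochain a b a = G.edgeCochain a b b := by
      funext s
      obtain ⟨e, rfl⟩ := exists_eq_single s
      rw [edgeCochain_single, edgeCochain_single]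
      split_ifs with h
      · rw [comp_single_eq_iff.2 (.inr h)]
      · rfl
    simp only [edgeClass, this]
  · intro a b c hab hbc hca
    refine hmk (⟨_, hG.edgeCochain_mem o a b c⟩ + ⟨_, hG.edgeCochain_mem o b c a⟩ +
      ⟨_, hG.edgeCochain_mem o c a b⟩) ?_
    exact ⟨_, vertexCochain_mem (sum_exponents_triple hab hbc hca),
      hG.d_vertexCochain_triple o hab hbc hca⟩
  · intro a b hab
    have h := hmk (∑ c, ⟨_, hG.edgeCochain_mem o a c b⟩) ?_
    · rw [← Submodule.mkQ_apply, map_sum] at h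
      exact h
    · rw [AddSubmonoidClass.coe_finsetSum]
      exact ⟨_, vertexCochain_mem (sum_exponents_star hab), hG.d_vertexCochain_star o hab⟩

/-- A cocycle is determined by its values on one edge of each parallel class, and each value expands
in the monomials one below the top. -/
theorem Loopless.sum_edgeCochain (hG : G.Loopless) (o : LinearOrder G.E)
    {f : G.Cochain (TruncPoly 3) 1} (hf : f ∈ G.cocycles o 3 1 G.coDegree) :
    ∑ p : Set.range G.ends, ∑ c : G.Comp (single (rep p)).1,
      coTopCoeff c (f (single (rep p))) • G.edgeCochain p.1.out.1 p.1.out.2 c.out = f := by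
  classical
  funext s
  obtain ⟨e, rfl⟩ := exists_eq_single s
  let p : Set.range G.ends := ⟨G.ends e, e, rfl⟩
  have hout : ∀ p' : Sym2 G.V, s(p'.out.1, p'.out.2) = p' := fun p' => Quot.out_eq p'
  have hpar : G.ends (rep p) = G.ends e := ends_rep p
  have hcoc := (hG.mem_cocycles_iff o hf.2).1 hf _ _ hpar
  rw [Finset.sum_apply, Fintype.sum_eq_single p]
  · rw [Finset.sum_apply, ← hcoc]
    conv_rhs => rw [eq_sum_coTop (hG.coDegree_eq (rep p)) (hf.2 (single (rep p)) trivial), map_sum]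
    refine Finset.sum_congr rfl fun c _ => ?_
    rw [Pi.smul_apply, edgeCochain_single, if_pos (hout _).symm, map_zsmul,
      fiberMul_coTop (leMap_bijective _ (single_le_of_parallel hpar.symm))]
    congr 2
    conv_rhs => rw [← comp_out c]
    rfl
  · intro p' hp'
    rw [Finset.sum_apply]
    refine Finset.sum_eq_zero fun c _ => ?_
    rw [Pi.smul_apply, edgeCochain_single, if_neg, smul_zero]
    rw [hout]
    exact fun h => hp' (Subtype.ext h.symm)

/-- The group `H^{1,2v-3}` of a loopless graph is the group of edge-vertex pairs. -/
theorem Loopless.nonempty_equiv_pairGroup (hG : G.Loopless) (o : LinearOrder G.E) :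
    Nonempty (G.firstCohomology o ≃ₗ[ℤ] G.pairGroup) := by
  let Ψ : G.firstCohomology o →ₗ[ℤ] G.pairGroup :=
    Submodule.liftQ _ (G.toPairs ∘ₗ (G.cocycles o 3 1 G.coDegree).subtype) fun x hx =>
      hG.toPairs_coboundary o hx
  have hΨ : ∀ x, Ψ (Submodule.Quotient.mk x) = G.toPairs x.1 := fun x => rfl
  refine ⟨LinearEquiv.ofLinearMap Ψ (lift _ (hG.isEdgeVertexFun_edgeClass o)) ?_ ?_⟩
  · apply hom_ext
    intro a b c
    rw [LinearMap.comp_apply, lift_of, edgeClass, hΨ, hG.toPairs_edgeCochain, LinearMap.id_apply]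
  · apply Submodule.linearMap_qext
    ext ⟨f, hf⟩
    rw [LinearMap.comp_apply, LinearMap.comp_apply, LinearMap.comp_apply, Submodule.mkQ_apply, hΨ,
      toPairs_apply]
    have hgen : ∀ p c, lift _ (hG.isEdgeVertexFun_edgeClass o) (G.pairGen p c) =
        hG.edgeClass o p.out.1 p.out.2 c := by
      intro p c
      conv_lhs => rw [← Quot.out_eq p]
      exact lift_of _ _ _ _ _
    simp only [map_sum, map_zsmul, hgen]
    have := congrArg (Submodule.mkQ ((G.coboundaries o 3 1 G.coDegree).submoduleOf
      (G.cocycles o 3 1 G.coDegree))) (Subtype.ext (a1 := ∑ p : Set.range G.ends,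
        ∑ c : G.Comp (single (rep p)).1, coTopCoeff c (f (single (rep p))) •
          (⟨_, hG.edgeCochain_mem o p.1.out.1 p.1.out.2 c.out⟩ : G.cocycles o 3 1 G.coDegree))
        (a2 := ⟨f, hf⟩) (by
          rw [AddSubmonoidClass.coe_finsetSum]
          simp only [AddSubmonoidClass.coe_finsetSum, SetLike.val_smul]
          exact hG.sum_edgeCochain o hf))
    simp only [map_sum, map_zsmul] at this
    exact this

end Multigraph

/-! ### Gluing -/

namespace Multigraph

variable {G H : Multigraph.{u}}

/-! ### Reduction to groups of edge-vertex pairs -/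

theorem not_loopless_iff : ¬ G.Loopless ↔ ∃ e, (G.ends e).IsDiag := by
  simp [Loopless]

/-- Two graphs have the same first cohomology if they are both loopless with isomorphic groups of
edge-vertex pairs, or both have a loop. -/
theorem nonempty_equiv_firstCohomology (hl : G.Loopless ↔ H.Loopless)
    (h : G.Loopless → Nonempty (G.pairGroup ≃ₗ[ℤ] H.pairGroup)) (o : LinearOrder G.E)
    (o' : LinearOrder H.E) : Nonempty (G.firstCohomology o ≃ₗ[ℤ] H.firstCohomology o') := by
  by_cases hG : G.Loopless
  · obtain ⟨f⟩ := hG.nonempty_equiv_pairGroup o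
    obtain ⟨g⟩ := h hG
    obtain ⟨k⟩ := (hl.1 hG).nonempty_equiv_pairGroup o'
    exact ⟨f.trans (g.trans k.symm)⟩
  · obtain ⟨e, he⟩ := not_loopless_iff.1 hG
    obtain ⟨e', he'⟩ := not_loopless_iff.1 (mt hl.2 hG)
    have := subsingleton_of_isDiag o 3 G.coDegree he
    have := subsingleton_of_isDiag o' 3 H.coDegree he'
    exact ⟨0⟩

theorem isDiag_map {α β : Type*} {f : α → β} {p : Sym2 α} (h : p.IsDiag) : (p.map f).IsDiag := by
  induction p with | _ a b =>
  exact congrArg f h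

theorem isDiag_map_iff {α β : Type*} {f : α → β} (hf : Function.Injective f) {p : Sym2 α} :
    (p.map f).IsDiag ↔ p.IsDiag := by
  induction p with | _ a b =>
  exact hf.eq_iff

theorem Iso.loopless_iff (f : Iso G H) : G.Loopless ↔ H.Loopless := by
  have h : ∀ e, (H.ends (f.edgeEquiv e)).IsDiag ↔ (G.ends e).IsDiag := fun e => by
    rw [f.ends_edgeEquiv, isDiag_map_iff f.vertexEquiv.injective]
  exact ⟨fun hG e => by
    obtain ⟨e, rfl⟩ := f.edgeEquiv.surjective e
    exact mt (h e).1 (hG e), fun hH e => mt (h e).2 (hH _)⟩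

/-- The isomorphism of underlying simple graphs given by an isomorphism of multigraphs. -/
def Iso.spanningIso (f : Iso G H) : G.spanning Set.univ ≃g H.spanning Set.univ where
  toEquiv := f.vertexEquiv
  map_rel_iff' := by
    intro a b
    rw [spanning_adj, spanning_adj, f.vertexEquiv.injective.ne_iff]
    refine and_congr_right fun _ => ?_
    simp only [Set.mem_univ, true_and]
    rw [← f.edgeEquiv.exists_congr_right]
    refine exists_congr fun e => ?_
    rw [f.ends_edgeEquiv, ← Sym2.map_mk, (Sym2.map.injective f.vertexEquiv.injective).eq_iff]

theorem Iso.nonempty_equiv (f : Iso G H) (o : LinearOrder G.E) (o' : LinearOrder H.E) :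
    Nonempty (G.firstCohomology o ≃ₗ[ℤ] H.firstCohomology o') :=
  nonempty_equiv_firstCohomology f.loopless_iff
    (fun _ => EdgeVertexGroup.nonempty_equiv_of_iso f.spanningIso) o o'

/-! ### Identification of distant vertices -/

theorem identify_adj {r : G.V → G.V → Prop} {x y : (G.identify r).V} :
    ((G.identify r).spanning Set.univ).Adj x y ↔
      x ≠ y ∧ ∃ a b, Quot.mk r a = x ∧ Quot.mk r b = y ∧ ∃ e, G.ends e = s(a, b) := by
  rw [spanning_adj]
  refine and_congr_right fun _ => ?_
  constructor
  · rintro ⟨e, -, he⟩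
    change (G.ends e).map (Quot.mk r) = _ at he
    induction h : G.ends e with | _ a b =>
    rw [h, Sym2.map_mk] at he
    rcases Sym2.eq_iff.1 he with ⟨rfl, rfl⟩ | ⟨rfl, rfl⟩
    · exact ⟨a, b, rfl, rfl, e, h⟩
    · exact ⟨b, a, rfl, rfl, e, h.trans Sym2.eq_swap⟩
  · rintro ⟨a, b, rfl, rfl, e, he⟩
    exact ⟨e, trivial, congrArg (Sym2.map (Quot.mk r)) he⟩

theorem quot_mk_eq_iff {V : Type*} {v w : V} {a b : V} :
    Quot.mk (fun a b => a = v ∧ b = w) a = Quot.mk (fun a b => a = v ∧ b = w) b ↔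
      a = b ∨ (a = v ∧ b = w) ∨ (a = w ∧ b = v) := by
  classical
  constructor
  · intro h
    -- The retraction sending `w` to `v` descends to the quotient and separates its classes.
    have := congrArg (Quot.lift (fun x => if x = w then v else x) (by rintro _ _ ⟨rfl, rfl⟩; simp))
      h
    simp only at this
    split_ifs at this <;> simp_all
  · rintro (rfl | ⟨rfl, rfl⟩ | ⟨rfl, rfl⟩)
    · rfl
    · exact Quot.sound ⟨rfl, rfl⟩
    · exact (Quot.sound ⟨rfl, rfl⟩).symm

/-- A distance function truncated at `5`. -/
noncomputable def truncDist (G : Multigraph.{u}) (v a : G.V) : ℤ :=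
  ((min (G.edist v a) 5).toNat : ℤ)

/-- Truncation keeps the function finite on other components, so infinite distances need no separate
treatment. -/
theorem truncDist_lipschitz (v : G.V) {a b : G.V} (h : (G.spanning Set.univ).Adj a b) :
    G.truncDist v a ≤ G.truncDist v b + 1 := by
  have h1 : G.edist v a ≤ G.edist v b + 1 := by
    refine (SimpleGraph.edist_triangle (v := b)).trans ?_
    rw [SimpleGraph.edist_eq_one_iff_adj.2 h.symm]
    rfl
  have h2 : min (G.edist v a) 5 ≤ min (G.edist v b) 5 + 1 := by
    rw [min_add]
    exact le_min ((min_le_left _ _).trans h1) ((min_le_right _ _).trans le_self_add)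
  have h3 : min (G.edist v b) 5 ≠ ⊤ := ne_top_of_le_ne_top (by simp) (min_le_right _ _)
  have h4 := ENat.toNat_le_toNat h2 (by simp)
  rw [ENat.toNat_add h3 (by simp)] at h4
  simp only [truncDist]
  exact_mod_cast h4

theorem truncDist_self (v : G.V) : G.truncDist v v = 0 := by
  simp [truncDist, edist]

theorem truncDist_eq_five {v w : G.V} (h : 4 < G.edist v w) : G.truncDist v w = 5 := by
  have : (5 : ℕ∞) ≤ G.edist v w := by
    have := Order.add_one_le_of_lt h
    norm_num at this
    exact this
  simp [truncDist, min_eq_right this]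

theorem farIdentification {v w : G.V} (h : 4 < G.edist v w) :
    EdgeVertexGroup.FarIdentification (G.spanning Set.univ)
      ((G.identifyVertices v w).spanning Set.univ) (Quot.mk _) v w (G.truncDist v) where
  surj := Quot.mk_surjective
  eq_iff a b := quot_mk_eq_iff
  left := truncDist_self v
  right := truncDist_eq_five h
  lipschitz a b hab := truncDist_lipschitz v hab
  adj_iff x y := by
    have hvw : ¬ (G.spanning Set.univ).Adj v w := fun hvw => by
      have h1 := truncDist_lipschitz v hvw.symm
      rw [truncDist_self, truncDist_eq_five h] at h1
      omega
    refine identify_adj.trans ?_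
    constructor
    · rintro ⟨hxy, a, b, rfl, rfl, e, he⟩
      exact ⟨a, b, rfl, rfl, spanning_adj.2 ⟨fun hab => hxy (by rw [hab]), e, trivial, he⟩⟩
    · rintro ⟨a, b, rfl, rfl, hab⟩
      obtain ⟨hne, e, -, he⟩ := spanning_adj.1 hab
      refine ⟨?_, a, b, rfl, rfl, e, he⟩
      intro hmk
      rcases quot_mk_eq_iff.1 hmk with h1 | ⟨rfl, rfl⟩ | ⟨rfl, rfl⟩
      · exact hne h1
      · exact hvw hab
      · exact hvw hab.symm

/-- As `v` and `w` are not adjacent, the identification makes no loop. -/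
theorem loopless_identifyVertices_iff {v w : G.V} (h : 4 < G.edist v w) :
    (G.identifyVertices v w).Loopless ↔ G.Loopless := by
  refine ⟨fun hG e he => hG e (isDiag_map he), fun hG e he => ?_⟩
  obtain ⟨a, b, hab, hab'⟩ := hG.exists_ends e
  have hadj := (farIdentification h).adj_map (spanning_adj.2 ⟨hab, e, trivial, hab'⟩)
  change ((G.ends e).map (Quot.mk _)).IsDiag at he
  rw [hab', Sym2.map_mk] at he
  exact hadj.ne he

theorem nonempty_equiv_identifyVertices {v w : G.V} (h : 4 < G.edist v w) (o : LinearOrder G.E)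
    (o' : LinearOrder (G.identifyVertices v w).E) :
    Nonempty ((G.identifyVertices v w).firstCohomology o' ≃ₗ[ℤ] G.firstCohomology o) :=
  nonempty_equiv_firstCohomology (loopless_identifyVertices_iff h)
    (fun _ => (farIdentification h).nonempty_equiv) o' o

/-! #### Disjoint unions and one-vertex products -/

theorem disjointUnion_exists_ends {x y : G.V ⊕ H.V} :
    (∃ e, (G.disjointUnion H).ends e = s(x, y)) ↔
      (∃ a b, x = .inl a ∧ y = .inl b ∧ ∃ e, G.ends e = s(a, b)) ∨
      (∃ a b, x = .inr a ∧ y = .inr b ∧ ∃ e, H.ends e = s(a, b)) := by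
  constructor
  · rintro ⟨e | e, he⟩
    · left
      change (G.ends e).map Sum.inl = _ at he
      induction h : G.ends e with | _ a b =>
      rw [h, Sym2.map_mk, Sym2.eq_iff] at he
      rcases he with ⟨rfl, rfl⟩ | ⟨rfl, rfl⟩
      · exact ⟨a, b, rfl, rfl, e, h⟩
      · exact ⟨b, a, rfl, rfl, e, h.trans Sym2.eq_swap⟩
    · right
      change (H.ends e).map Sum.inr = _ at he
      induction h : H.ends e with | _ a b =>
      rw [h, Sym2.map_mk, Sym2.eq_iff] at he
      rcases he with ⟨rfl, rfl⟩ | ⟨rfl, rfl⟩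
      · exact ⟨a, b, rfl, rfl, e, h⟩
      · exact ⟨b, a, rfl, rfl, e, h.trans Sym2.eq_swap⟩
  · rintro (⟨a, b, rfl, rfl, e, he⟩ | ⟨a, b, rfl, rfl, e, he⟩)
    · refine ⟨.inl e, ?_⟩
      change (G.ends e).map Sum.inl = _
      rw [he, Sym2.map_mk]
    · refine ⟨.inr e, ?_⟩
      change (H.ends e).map Sum.inr = _
      rw [he, Sym2.map_mk]

theorem disjointUnion_adj {x y : (G.disjointUnion H).V} :
    ((G.disjointUnion H).spanning Set.univ).Adj x y ↔
      (G.spanning Set.univ ⊕g H.spanning Set.univ).Adj x y := by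
  rw [spanning_adj]
  simp only [Set.mem_univ, true_and]
  refine (and_congr_right fun _ => disjointUnion_exists_ends).trans ?_
  rcases x with x | x <;> rcases y with y | y <;> simp [spanning_adj]
  · exact fun _ _ => Sum.inl_injective.ne_iff
  · exact fun _ _ => Sum.inr_injective.ne_iff

theorem loopless_disjointUnion_iff : (G.disjointUnion H).Loopless ↔ G.Loopless ∧ H.Loopless := by
  constructor
  · exact fun h => ⟨fun e he => h (.inl e) (isDiag_map he), fun e he => h (.inr e) (isDiag_map he)⟩
  · rintro ⟨hG, hH⟩ (e | e) he
    · exact hG e ((isDiag_map_iff Sum.inl_injective).1 he)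
    · exact hH e ((isDiag_map_iff Sum.inr_injective).1 he)

theorem nonempty_equiv_disjointUnion : Nonempty ((G.disjointUnion H).pairGroup ≃ₗ[ℤ]
    G.pairGroup × H.pairGroup) := by
  obtain ⟨f⟩ := EdgeVertexGroup.nonempty_equiv_of_iso
    (S := (G.disjointUnion H).spanning Set.univ)
    (S' := G.spanning Set.univ ⊕g H.spanning Set.univ)
    { toEquiv := Equiv.refl (G.V ⊕ H.V), map_rel_iff' := disjointUnion_adj.symm }
  obtain ⟨g⟩ := EdgeVertexGroup.nonempty_equiv_prod (G.spanning Set.univ) (H.spanning Set.univ)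
  exact ⟨f.trans g⟩

theorem edist_disjointUnion (v : G.V) (w : H.V) :
    (G.disjointUnion H).edist (Sum.inl v) (Sum.inr w) = ⊤ := by
  apply SimpleGraph.edist_eq_top_of_not_reachable
  intro h
  have h := (SimpleGraph.reachable_iff_reflTransGen _ _).1 h
  have key : ∀ x : (G.disjointUnion H).V, Relation.ReflTransGen
      ((G.disjointUnion H).spanning Set.univ).Adj (Sum.inl v) x → ∃ a, x = .inl a := by
    intro x hx
    induction hx with
    | refl => exact ⟨v, rfl⟩
    | tail _ hstep ih =>
      obtain ⟨a, rfl⟩ := ih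
      rename_i c _
      rcases c with c | c
      · exact ⟨c, rfl⟩
      · have := disjointUnion_adj.1 hstep
        simp at this
  obtain ⟨a, ha⟩ := key _ h
  cases ha

theorem lt_edist_disjointUnion (v : G.V) (w : H.V) :
    4 < (G.disjointUnion H).edist (Sum.inl v) (Sum.inr w) := by
  rw [edist_disjointUnion]
  exact ENat.natCast_lt_top 4

theorem loopless_oneVertexProduct_iff (v : G.V) (w : H.V) :
    (G.oneVertexProduct H v w).Loopless ↔ G.Loopless ∧ H.Loopless :=
  (loopless_identifyVertices_iff (lt_edist_disjointUnion v w)).trans loopless_disjointUnion_iff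

/-- The glued vertices lie at infinite distance in the disjoint union, so the group does not depend
on where the gluing takes place. -/
theorem nonempty_equiv_oneVertexProduct (v : G.V) (w : H.V) :
    Nonempty ((G.oneVertexProduct H v w).pairGroup ≃ₗ[ℤ] G.pairGroup × H.pairGroup) := by
  obtain ⟨f⟩ := (farIdentification (lt_edist_disjointUnion v w)).nonempty_equiv
  obtain ⟨g⟩ := nonempty_equiv_disjointUnion (G := G) (H := H)
  exact ⟨f.trans g⟩

/-! #### Two-vertex products -/

section TwoVertex

/-- The vertex of the two-vertex product given by a vertex of the first factor. -/
def glueLeft (v₁ v₂ : G.V) (w₁ w₂ : H.V) (a : G.V) : (G.twoVertexProduct H v₁ v₂ w₁ w₂).V :=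
  Quot.mk _ (Sum.inl a)

/-- The vertex of the two-vertex product given by a vertex of the second factor. -/
def glueRight (v₁ v₂ : G.V) (w₁ w₂ : H.V) (b : H.V) : (G.twoVertexProduct H v₁ v₂ w₁ w₂).V :=
  Quot.mk _ (Sum.inr b)

variable {v₁ v₂ : G.V} {w₁ w₂ : H.V}

theorem glueLeft_fst : glueLeft v₁ v₂ w₁ w₂ v₁ = glueRight v₁ v₂ w₁ w₂ w₁ :=
  Quot.sound (.inl ⟨rfl, rfl⟩)

theorem glueLeft_snd : glueLeft v₁ v₂ w₁ w₂ v₂ = glueRight v₁ v₂ w₁ w₂ w₂ :=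
  Quot.sound (.inr ⟨rfl, rfl⟩)

theorem glue_cases (x : (G.twoVertexProduct H v₁ v₂ w₁ w₂).V) :
    (∃ a, x = glueLeft v₁ v₂ w₁ w₂ a) ∨ ∃ b, x = glueRight v₁ v₂ w₁ w₂ b := by
  induction x using Quot.ind with | _ x =>
  rcases x with a | b
  · exact .inl ⟨a, rfl⟩
  · exact .inr ⟨b, rfl⟩

open Classical in
/-- A normal form for the vertices of the two-vertex product. -/
noncomputable def glueNormal (hw : w₁ ≠ w₂) :
    (G.twoVertexProduct H v₁ v₂ w₁ w₂).V → G.V ⊕ H.V :=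
  Quot.lift (Sum.elim .inl fun h => if h = w₁ then .inl v₁ else if h = w₂ then .inl v₂ else .inr h)
    (by rintro _ _ (⟨rfl, rfl⟩ | ⟨rfl, rfl⟩) <;> simp [hw.symm])

theorem glueNormal_glueLeft (hw : w₁ ≠ w₂) (a : G.V) :
    glueNormal hw (glueLeft v₁ v₂ w₁ w₂ a) = .inl a := rfl

open Classical in
theorem glueNormal_glueRight (hw : w₁ ≠ w₂) (b : H.V) :
    glueNormal hw (glueRight v₁ v₂ w₁ w₂ b) =
      if b = w₁ then .inl v₁ else if b = w₂ then .inl v₂ else .inr b := rfl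

theorem glueLeft_injective (hw : w₁ ≠ w₂) : Function.Injective (glueLeft v₁ v₂ w₁ w₂) :=
  fun _ _ h => Sum.inl_injective (congrArg (glueNormal hw) h)

theorem glueRight_injective (hv : v₁ ≠ v₂) (hw : w₁ ≠ w₂) :
    Function.Injective (glueRight v₁ v₂ w₁ w₂) := by
  classical
  intro a b h
  have := congrArg (glueNormal hw) h
  simp only [glueNormal_glueRight] at this
  split_ifs at this <;> simp_all

theorem glueLeft_eq_glueRight (hw : w₁ ≠ w₂) {a : G.V} {b : H.V}
    (h : glueLeft v₁ v₂ w₁ w₂ a = glueRight v₁ v₂ w₁ w₂ b) :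
    (a = v₁ ∧ b = w₁) ∨ (a = v₂ ∧ b = w₂) := by
  classical
  have := congrArg (glueNormal hw) h
  rw [glueNormal_glueRight, glueNormal_glueLeft] at this
  split_ifs at this <;> simp_all

theorem loopless_twoVertexProduct_iff (hv : v₁ ≠ v₂) (hw : w₁ ≠ w₂) :
    (G.twoVertexProduct H v₁ v₂ w₁ w₂).Loopless ↔ G.Loopless ∧ H.Loopless := by
  have hl : ∀ e, ((G.twoVertexProduct H v₁ v₂ w₁ w₂).ends (Sum.inl e)).IsDiag ↔
      (G.ends e).IsDiag := by
    intro e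
    rw [← isDiag_map_iff (glueLeft_injective (v₁ := v₁) (v₂ := v₂) hw)]
    exact Eq.to_iff (congrArg Sym2.IsDiag (Sym2.map_map _))
  have hr : ∀ e, ((G.twoVertexProduct H v₁ v₂ w₁ w₂).ends (Sum.inr e)).IsDiag ↔
      (H.ends e).IsDiag := by
    intro e
    rw [← isDiag_map_iff (glueRight_injective hv hw)]
    exact Eq.to_iff (congrArg Sym2.IsDiag (Sym2.map_map _))
  constructor
  · exact fun h => ⟨fun e he => h (Sum.inl e) ((hl e).2 he), fun e he => h (Sum.inr e) ((hr e).2 he)⟩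
  · rintro ⟨hG, hH⟩ (e | e)
    · exact mt (hl e).1 (hG e)
    · exact mt (hr e).1 (hH e)

theorem twoVertexProduct_adj {x y : (G.twoVertexProduct H v₁ v₂ w₁ w₂).V} :
    ((G.twoVertexProduct H v₁ v₂ w₁ w₂).spanning Set.univ).Adj x y ↔ x ≠ y ∧
      ((∃ a b, glueLeft v₁ v₂ w₁ w₂ a = x ∧ glueLeft v₁ v₂ w₁ w₂ b = y ∧
          ∃ e, G.ends e = s(a, b)) ∨
        ∃ a b, glueRight v₁ v₂ w₁ w₂ a = x ∧ glueRight v₁ v₂ w₁ w₂ b = y ∧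
          ∃ e, H.ends e = s(a, b)) := by
  refine identify_adj.trans (and_congr_right fun _ => ?_)
  have h := @disjointUnion_exists_ends G H
  constructor
  · rintro ⟨a, b, rfl, rfl, hab⟩
    rcases h.1 hab with ⟨a, b, rfl, rfl, he⟩ | ⟨a, b, rfl, rfl, he⟩
    · exact .inl ⟨a, b, rfl, rfl, he⟩
    · exact .inr ⟨a, b, rfl, rfl, he⟩
  · rintro (⟨a, b, rfl, rfl, he⟩ | ⟨a, b, rfl, rfl, he⟩)
    · exact ⟨_, _, rfl, rfl, h.2 (.inl ⟨a, b, rfl, rfl, he⟩)⟩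
    · exact ⟨_, _, rfl, rfl, h.2 (.inr ⟨a, b, rfl, rfl, he⟩)⟩

open Classical in
/-- The map on vertices from a two-vertex product to its Whitney flip that is the identity on the
second factor. -/
noncomputable def flipMap (v₁ v₂ : G.V) (w₁ w₂ : H.V) :
    (G.twoVertexProduct H v₁ v₂ w₁ w₂).V → (G.twoVertexProduct H v₁ v₂ w₂ w₁).V :=
  Quot.lift (Sum.elim (fun a => glueLeft v₁ v₂ w₂ w₁ (Equiv.swap v₁ v₂ a))
    (glueRight v₁ v₂ w₂ w₁)) (by
      rintro _ _ (⟨rfl, rfl⟩ | ⟨rfl, rfl⟩)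
      · simp [glueLeft_snd]
      · simp [glueLeft_fst])

open Classical in
theorem flipMap_glueLeft (a : G.V) : flipMap v₁ v₂ w₁ w₂ (glueLeft v₁ v₂ w₁ w₂ a) =
    glueLeft v₁ v₂ w₂ w₁ (Equiv.swap v₁ v₂ a) := rfl

theorem flipMap_glueRight (b : H.V) : flipMap v₁ v₂ w₁ w₂ (glueRight v₁ v₂ w₁ w₂ b) =
    glueRight v₁ v₂ w₂ w₁ b := rfl

theorem flipMap_flipMap (x : (G.twoVertexProduct H v₁ v₂ w₁ w₂).V) :
    flipMap v₁ v₂ w₂ w₁ (flipMap v₁ v₂ w₁ w₂ x) = x := by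
  classical
  rcases glue_cases x with ⟨a, rfl⟩ | ⟨b, rfl⟩
  · rw [flipMap_glueLeft, flipMap_glueLeft, Equiv.swap_apply_self]
  · rfl

/-- The bijection between the vertices of a two-vertex product and those of its Whitney flip. -/
noncomputable def flipEquiv (v₁ v₂ : G.V) (w₁ w₂ : H.V) :
    (G.twoVertexProduct H v₁ v₂ w₁ w₂).V ≃ (G.twoVertexProduct H v₁ v₂ w₂ w₁).V where
  toFun := flipMap v₁ v₂ w₁ w₂
  invFun := flipMap v₁ v₂ w₂ w₁
  left_inv := flipMap_flipMap
  right_inv := flipMap_flipMap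

/-- The vertices of the first factor that are not glued. -/
def firstSide (v₁ v₂ : G.V) (w₁ w₂ : H.V) : Set (G.twoVertexProduct H v₁ v₂ w₁ w₂).V :=
  {x | ∃ a, a ≠ v₁ ∧ a ≠ v₂ ∧ x = glueLeft v₁ v₂ w₁ w₂ a}

theorem glueRight_notMem (hw : w₁ ≠ w₂) (b : H.V) :
    glueRight v₁ v₂ w₁ w₂ b ∉ firstSide v₁ v₂ w₁ w₂ := by
  rintro ⟨a, h1, h2, h⟩
  have := glueLeft_eq_glueRight hw h.symm
  tauto

theorem glueLeft_mem_iff (hw : w₁ ≠ w₂) (a : G.V) :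
    glueLeft v₁ v₂ w₁ w₂ a ∈ firstSide v₁ v₂ w₁ w₂ ↔ a ≠ v₁ ∧ a ≠ v₂ := by
  constructor
  · rintro ⟨a', h1, h2, h⟩
    rw [glueLeft_injective hw h]
    exact ⟨h1, h2⟩
  · exact fun h => ⟨a, h.1, h.2, rfl⟩

open Classical in
theorem swap_glueLeft (hw : w₁ ≠ w₂) (a : G.V) :
    Equiv.swap (glueLeft v₁ v₂ w₁ w₂ v₁) (glueLeft v₁ v₂ w₁ w₂ v₂) (glueLeft v₁ v₂ w₁ w₂ a) =
      glueLeft v₁ v₂ w₁ w₂ (Equiv.swap v₁ v₂ a) := by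
  rw [Equiv.swap_apply_def, Equiv.swap_apply_def, (glueLeft_injective hw).eq_iff,
    (glueLeft_injective hw).eq_iff]
  split_ifs <;> rfl

/-- The simple graph of the Whitney flip, on the vertices of the original two-vertex product. -/
noncomputable def flipGraph (v₁ v₂ : G.V) (w₁ w₂ : H.V) :
    SimpleGraph (G.twoVertexProduct H v₁ v₂ w₁ w₂).V :=
  ((G.twoVertexProduct H v₁ v₂ w₂ w₁).spanning Set.univ).comap (flipEquiv v₁ v₂ w₁ w₂)

open Classical in
theorem flipGraph_adj {x y : (G.twoVertexProduct H v₁ v₂ w₁ w₂).V} :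
    (flipGraph v₁ v₂ w₁ w₂).Adj x y ↔ x ≠ y ∧
      ((∃ a b, glueLeft v₁ v₂ w₁ w₂ (Equiv.swap v₁ v₂ a) = x ∧
          glueLeft v₁ v₂ w₁ w₂ (Equiv.swap v₁ v₂ b) = y ∧ ∃ e, G.ends e = s(a, b)) ∨
        ∃ a b, glueRight v₁ v₂ w₁ w₂ a = x ∧ glueRight v₁ v₂ w₁ w₂ b = y ∧
          ∃ e, H.ends e = s(a, b)) := by
  have hl : ∀ a x, glueLeft v₁ v₂ w₂ w₁ a = flipMap v₁ v₂ w₁ w₂ x ↔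
      glueLeft v₁ v₂ w₁ w₂ (Equiv.swap v₁ v₂ a) = x := fun a x => by
    constructor
    · intro h
      have h := congrArg (flipMap v₁ v₂ w₂ w₁) h
      rwa [flipMap_glueLeft, flipMap_flipMap] at h
    · rintro rfl
      rw [flipMap_glueLeft, Equiv.swap_apply_self]
  have hr : ∀ b x, glueRight v₁ v₂ w₂ w₁ b = flipMap v₁ v₂ w₁ w₂ x ↔
      glueRight v₁ v₂ w₁ w₂ b = x := fun b x => by
    constructor
    · intro h
      have h := congrArg (flipMap v₁ v₂ w₂ w₁) h
      rwa [flipMap_glueRight, flipMap_flipMap] at h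
    · rintro rfl
      rfl
  refine twoVertexProduct_adj.trans ?_
  change flipMap v₁ v₂ w₁ w₂ x ≠ flipMap v₁ v₂ w₁ w₂ y ∧ (
    (∃ a b, _ = flipMap v₁ v₂ w₁ w₂ x ∧ _ = flipMap v₁ v₂ w₁ w₂ y ∧ _) ∨
      ∃ a b, _ = flipMap v₁ v₂ w₁ w₂ x ∧ _ = flipMap v₁ v₂ w₁ w₂ y ∧ _) ↔ _
  simp only [hl, hr]
  exact and_congr_left fun _ => (flipEquiv v₁ v₂ w₁ w₂).injective.ne_iff

-- Read on the vertices of the unflipped product, the flip exchanges `v₁` and `v₂` in the edges of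
-- `G` and leaves those of `H` in place.
open Classical in
theorem simpleWhitneyFlip (hv : v₁ ≠ v₂) (hw : w₁ ≠ w₂) :
    SimpleWhitneyFlip ((G.twoVertexProduct H v₁ v₂ w₁ w₂).spanning Set.univ)
      (flipGraph v₁ v₂ w₁ w₂) (firstSide v₁ v₂ w₁ w₂) (glueLeft v₁ v₂ w₁ w₂ v₁)
      (glueLeft v₁ v₂ w₁ w₂ v₂) where
  left := by simp [glueLeft_mem_iff hw]
  right := by simp [glueLeft_mem_iff hw]
  ne := (glueLeft_injective hw).ne hv
  sep x y hx hy hy1 hy2 hxy := by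
    rcases (twoVertexProduct_adj.1 hxy).2 with ⟨a, b, rfl, rfl, -⟩ | ⟨a, b, rfl, rfl, -⟩
    · rw [glueLeft_mem_iff hw] at hy
      grind
    · exact glueRight_notMem hw a hx
  inside x y hxy := by
    have hnot : ∀ a b, ¬ (glueRight v₁ v₂ w₁ w₂ a = x ∧ glueRight v₁ v₂ w₁ w₂ b = y) := by
      rintro a b ⟨rfl, rfl⟩
      exact hxy.elim (glueRight_notMem hw a) (glueRight_notMem hw b)
    have hnot' : ∀ a b, ¬ (glueRight v₁ v₂ w₁ w₂ a = Equiv.swap (glueLeft v₁ v₂ w₁ w₂ v₁)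
        (glueLeft v₁ v₂ w₁ w₂ v₂) x ∧ glueRight v₁ v₂ w₁ w₂ b =
          Equiv.swap (glueLeft v₁ v₂ w₁ w₂ v₁) (glueLeft v₁ v₂ w₁ w₂ v₂) y) := by
      rintro a b ⟨h1, h2⟩
      rcases hxy with ⟨c, hc, hc', rfl⟩ | ⟨c, hc, hc', rfl⟩
      · rw [swap_glueLeft hw, Equiv.swap_apply_of_ne_of_ne hc hc'] at h1
        exact glueRight_notMem hw a (h1 ▸ (glueLeft_mem_iff hw c).2 ⟨hc, hc'⟩)
      · rw [swap_glueLeft hw, Equiv.swap_apply_of_ne_of_ne hc hc'] at h2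
        exact glueRight_notMem hw b (h2 ▸ (glueLeft_mem_iff hw c).2 ⟨hc, hc'⟩)
    rw [flipGraph_adj, twoVertexProduct_adj, (Equiv.injective _).ne_iff]
    refine and_congr_right fun _ => ?_
    constructor
    · rintro (⟨a, b, rfl, rfl, he⟩ | ⟨a, b, h1, h2, -⟩)
      · refine .inl ⟨a, b, ?_, ?_, he⟩ <;> rw [swap_glueLeft hw, Equiv.swap_apply_self]
      · exact absurd ⟨h1, h2⟩ (hnot a b)
    · rintro (⟨a, b, h1, h2, he⟩ | ⟨a, b, h1, h2, -⟩)
      · refine .inl ⟨a, b, ?_, ?_, he⟩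
        · rw [← swap_glueLeft hw, h1, Equiv.swap_apply_self]
        · rw [← swap_glueLeft hw, h2, Equiv.swap_apply_self]
      · exact absurd ⟨h1, h2⟩ (hnot' a b)
  outside x y hx hy := by
    rw [flipGraph_adj, twoVertexProduct_adj]
    refine and_congr_right fun hxy => or_congr_left ?_
    -- An edge of `G` with both ends glued joins `v₁` and `v₂`; the swap only reverses it.
    have key : ∀ a b, glueLeft v₁ v₂ w₁ w₂ a ∉ firstSide v₁ v₂ w₁ w₂ →
        glueLeft v₁ v₂ w₁ w₂ b ∉ firstSide v₁ v₂ w₁ w₂ → a ≠ b →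
          Equiv.swap v₁ v₂ a = b ∧ Equiv.swap v₁ v₂ b = a := by
      intro a b ha hb hab
      rw [glueLeft_mem_iff hw] at ha hb
      have ha' : a = v₁ ∨ a = v₂ := by tauto
      have hb' : b = v₁ ∨ b = v₂ := by tauto
      rcases ha' with rfl | rfl <;> rcases hb' with rfl | rfl <;> simp_all
    constructor
    · rintro ⟨a, b, rfl, rfl, e, he⟩
      have h := key _ _ hx hy fun h => hxy (by rw [h])
      rw [Equiv.swap_apply_self, Equiv.swap_apply_self] at h
      exact ⟨b, a, congrArg _ h.2, congrArg _ h.1, e, he.trans Sym2.eq_swap⟩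
    · rintro ⟨a, b, rfl, rfl, e, he⟩
      have h := key _ _ hx hy fun h => hxy (by rw [h])
      exact ⟨b, a, by rw [h.2], by rw [h.1], e, he.trans Sym2.eq_swap⟩

theorem nonempty_equiv_twoVertexProduct (hv : v₁ ≠ v₂) (hw : w₁ ≠ w₂) :
    Nonempty ((G.twoVertexProduct H v₁ v₂ w₁ w₂).pairGroup ≃ₗ[ℤ]
      (G.twoVertexProduct H v₁ v₂ w₂ w₁).pairGroup) := by
  classical
  obtain ⟨f⟩ := SimpleWhitneyFlip.nonempty_equiv (simpleWhitneyFlip (G := G) (H := H) hv hw)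
  obtain ⟨g⟩ := EdgeVertexGroup.nonempty_equiv_of_iso
    (S := flipGraph v₁ v₂ w₁ w₂) (S' := (G.twoVertexProduct H v₁ v₂ w₂ w₁).spanning Set.univ)
    { toEquiv := flipEquiv v₁ v₂ w₁ w₂, map_rel_iff' := Iff.rfl }
  exact ⟨f.trans g⟩

theorem nonempty_equiv_whitneyFlip (hv : v₁ ≠ v₂) (hw : w₁ ≠ w₂)
    (o : LinearOrder (G.twoVertexProduct H v₁ v₂ w₁ w₂).E)
    (o' : LinearOrder (G.twoVertexProduct H v₁ v₂ w₂ w₁).E) :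
    Nonempty ((G.twoVertexProduct H v₁ v₂ w₁ w₂).firstCohomology o ≃ₗ[ℤ]
      (G.twoVertexProduct H v₁ v₂ w₂ w₁).firstCohomology o') :=
  nonempty_equiv_firstCohomology ((loopless_twoVertexProduct_iff hv hw).trans
    (loopless_twoVertexProduct_iff hv hw.symm).symm)
    (fun _ => nonempty_equiv_twoVertexProduct hv hw) o o'

end TwoVertex

/-! ### Invariance under 2-isomorphism -/

theorem TwoIsomorphic.nonempty_equiv (h : TwoIsomorphic G H) :
    ∀ (o : LinearOrder G.E) (o' : LinearOrder H.E),
      Nonempty (G.firstCohomology o ≃ₗ[ℤ] H.firstCohomology o') := by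
  induction h with
  | iso f => exact f.nonempty_equiv
  | oneVertex G H v v' w w' =>
    refine nonempty_equiv_firstCohomology ((loopless_oneVertexProduct_iff v w).trans
      (loopless_oneVertexProduct_iff v' w').symm) fun _ => ?_
    obtain ⟨f⟩ := nonempty_equiv_oneVertexProduct v w
    obtain ⟨g⟩ := nonempty_equiv_oneVertexProduct v' w'
    exact ⟨f.trans g.symm⟩
  | whitneyFlip G H v₁ v₂ w₁ w₂ hv hw => exact nonempty_equiv_whitneyFlip hv hw
  | symm _ ih => exact fun o o' => (ih o' o).map LinearEquiv.symm
  | @trans G₁ G₂ G₃ _ _ ih ih' =>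
    intro o o'
    -- The intermediate graph comes without an edge order; any choice will do.
    let o₂ : LinearOrder G₂.E := LinearOrder.lift' (Finite.equivFin G₂.E) (Equiv.injective _)
    obtain ⟨f⟩ := ih o o₂
    obtain ⟨g⟩ := ih' o₂ o'
    exact ⟨f.trans g⟩

end Multigraph

theorem theorem6p2 :
    -- (1) identifying two vertices at distance greater than 4, possibly infinite
    (∀ (Y : Multigraph.{u}) (v w : Y.V), 4 < Y.edist v w →
      ∀ (o : LinearOrder Y.E) (o' : LinearOrder (Y.identifyVertices v w).E),
        Nonempty ((Y.identifyVertices v w).firstCohomology o' ≃ₗ[ℤ] Y.firstCohomology o)) ∧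
    -- in particular, additivity for one-vertex products of loopless multigraphs
    (∀ (G H : Multigraph.{u}) (v : G.V) (w : H.V), G.Loopless → H.Loopless →
      ∀ (oG : LinearOrder G.E) (oH : LinearOrder H.E)
        (o : LinearOrder (G.oneVertexProduct H v w).E),
        Nonempty ((G.oneVertexProduct H v w).firstCohomology o ≃ₗ[ℤ]
          G.firstCohomology oG × H.firstCohomology oH)) ∧
    -- (2) invariance under Whitney flips
    (∀ (G H : Multigraph.{u}) (v₁ v₂ : G.V) (w₁ w₂ : H.V), v₁ ≠ v₂ → w₁ ≠ w₂ →
      ∀ (o : LinearOrder (G.twoVertexProduct H v₁ v₂ w₁ w₂).E)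
        (o' : LinearOrder (G.twoVertexProduct H v₁ v₂ w₂ w₁).E),
        Nonempty ((G.twoVertexProduct H v₁ v₂ w₁ w₂).firstCohomology o ≃ₗ[ℤ]
          (G.twoVertexProduct H v₁ v₂ w₂ w₁).firstCohomology o')) ∧
    -- (3) invariance under 2-isomorphism
    (∀ G₁ G₂ : Multigraph.{u}, Multigraph.TwoIsomorphic G₁ G₂ →
      ∀ (o₁ : LinearOrder G₁.E) (o₂ : LinearOrder G₂.E),
        Nonempty (G₁.firstCohomology o₁ ≃ₗ[ℤ] G₂.firstCohomology o₂)) := by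
  refine ⟨fun Y v w h o o' => Multigraph.nonempty_equiv_identifyVertices h o o',
    fun G H v w hG hH oG oH o => ?_,
    fun G H v₁ v₂ w₁ w₂ hv hw o o' => Multigraph.nonempty_equiv_whitneyFlip hv hw o o',
    fun G₁ G₂ h o₁ o₂ => h.nonempty_equiv o₁ o₂⟩
  obtain ⟨f⟩ := hG.nonempty_equiv_pairGroup oG
  obtain ⟨g⟩ := hH.nonempty_equiv_pairGroup oH
  obtain ⟨k⟩ := ((Multigraph.loopless_oneVertexProduct_iff v w).2
    ⟨hG, hH⟩).nonempty_equiv_pairGroup o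
  obtain ⟨l⟩ := Multigraph.nonempty_equiv_oneVertexProduct v w
  exact ⟨(k.trans l).trans (f.prodCongr g).symm⟩
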